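/- Fix integers $n\ge 3$ and $k\ge 1$. Consider the circular tournament on players $1,\dots,n$ in which every player cites each of its two neighbours $k$ times: its citation matrix $C=(c_{ij})$ ($c_{ij}$ being the number of times $i$ beats, i.e. is cited by, $j$) is the $n\times n$ circulant matrix with first column $(0,k,0,\dots,0,k)^T$. The (normalized) influence weight of a matrix $C$ is the vector $w$ with $w_i=\bigl(\sum_j w_jc_{ij}\bigr)/\bigl(\sum_j c_{ji}\bigr)$ for all $i$ and $\sum_i w_i=1$; for the circular tournament it is $w=(1/n,\dots,1/n)$, and it is the only one. For $t=(t_{ij})_{i<j}$ let $C_t=C+\sum_{i<j}t_{ij}F_{ij}$, where $F_{ij}$ has entry $1$ at $(i,j)$, $-1$ at $(j,i)$ and zeros elsewhere. The map $t\mapsto \log w(C_t)$ is differentiable at $t=0$; let $J$ be its Jacobian there. Let $\Sigma$ be the covariance matrix of independent binomial counts $(c_{ij})_{i<j}$ with $c_{ij}+c_{ji}$ trials (that is, $2k$ for neighbours, $0$ otherwise) and success probability $1/2$. Then the delta-method covariance matrix $J\Sigma J^T$ of the log influence weights has entries $$\bigl[J\Sigma J^T\bigr]_{ij}=\frac{n^2-1-6d(n-d)}{6kn},\qquad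 d=|i-j|.$$ In particular the variances are $\frac{n^2-1}{6kn}$, the entries with $|i-j|=1$ are $\frac{(n-1)(n-5)}{6kn}$, and the entries with $|i-j|=2$ are $\frac{n^2-12n+23}{6kn}$. Under the Bradley–Terry model the counts $c_{ij}$, $i<j$, are independent binomials with log odds of success $\mu_i-\mu_j$. The maximum likelihood estimates of $\mu$ from the data $C$ are exactly the vectors with all abilities equal. At equal abilities, the asymptotic covariance matrix of the Bradley–Terry log-abilities, normalized so that their exponentials sum to $1$ (that is, the inverse Fisher information with the ability of one reference player held fixed, bordered by zeros and transformed by the Jacobian of $\mu\mapsto\mu-\log\sum_je^{\mu_j}$), exists and equals $J\Sigma J^T$. Consequently the log influence weight is an asymptotically efficient estimator for the circular tournament with equal abilities: if $X_m$ is the matrix of win counts in $m$ independent replicates of the tournament ($2km$ comparisons between each pair of neighbours, all abilities equal), then $\sqrt m\,\bigl(\log w(X_m)-\log(1/n)\bigr)$ converges in distribution, as $m\to\infty$, to a centred Gaussian vector whose covariance matrix is that inverse-Fisher-information matrix. (Where $w(X_m)$ is not uniquely defined, $\log w(X_m)$ is set to $0$, as are logarithms of zero entries.) -/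

import Mathlib

open MeasureTheory ProbabilityTheory Filter Topology Matrix

noncomputable section

namespace PairedComparison

variable {n : ℕ}

/-! ### Influence weights -/

/-- `C i j` is the number of times `i` beats (is cited by) `j`.  A vector `w` is a (normalized)
influence weight of `C` if all column sums `c_{·i} = ∑ j, C j i` are nonzero,
`w i = (∑ j, w j * C i j) / ∑ j, C j i` for all `i`, and the entries of `w` sum to one. -/
def IsInfluenceWeight (C : Matrix (Fin n) (Fin n) ℝ) (w : Fin n → ℝ) : Prop :=
  (∀ i, ∑ j, C j i ≠ 0) ∧
  (∀ i, w i = (∑ j, w j * C i j) / ∑ j, C j i) ∧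
  ∑ i, w i = 1

open Classical in
/-- The influence weight of `C`, when `C` has exactly one; the zero vector otherwise. -/
def influenceWeight (C : Matrix (Fin n) (Fin n) ℝ) : Fin n → ℝ :=
  if h : ∃! w, IsInfluenceWeight C w then h.choose else 0

/-- The entrywise logarithm of the influence weight. -/
def logInfluenceWeight (C : Matrix (Fin n) (Fin n) ℝ) : Fin n → ℝ :=
  fun i => Real.log (influenceWeight C i)

/-! ### Pairings, perturbations, Jacobians -/

/-- The positions of the strict upper triangle of an `n × n` matrix. -/
abbrev Pairing (n : ℕ) : Type := {p : Fin n × Fin n // p.1 < p.2}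

/-- `C + ∑ t_{ij} F_{ij}` over `i < j`, where `F_{ij}` has entry `1` at `(i, j)`, entry `-1` at
`(j, i)`, and zeros elsewhere. -/
def perturb (C : Matrix (Fin n) (Fin n) ℝ) (t : Pairing n → ℝ) : Matrix (Fin n) (Fin n) ℝ :=
  C + ∑ p : Pairing n,
    t p • (Matrix.single p.1.1 p.1.2 (1 : ℝ) - Matrix.single p.1.2 p.1.1 (1 : ℝ))

/-- The Jacobian matrix of `f` at `x`. -/
def jacobian {ι κ : Type*} [Fintype ι] [DecidableEq ι] [Fintype κ]
    (f : (ι → ℝ) → (κ → ℝ)) (x : ι → ℝ) : Matrix κ ι ℝ :=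
  Matrix.of fun a b => fderiv ℝ f x (Pi.single b 1) a

/-! ### The Bradley-Terry model -/

/-- The law of Bradley-Terry data: `N i j` is the number of comparisons between `i` and `j`, and for
`i < j` the number of wins of `i` over `j` is binomial with `N i j` trials and log odds of success
`μ i - μ j`, independently over pairs. -/
def btLaw (N : Matrix (Fin n) (Fin n) ℕ) (μ : Fin n → ℝ) : Measure (Pairing n → ℕ) :=
  Measure.pi fun p => binomial (N p.1.1 p.1.2) (unitInterval.sigmoid (μ p.1.1 - μ p.1.2))

instance (N : Matrix (Fin n) (Fin n) ℕ) (μ : Fin n → ℝ) : IsProbabilityMeasure (btLaw N μ) := by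
  unfold btLaw; infer_instance

/-- The matrix of wins: `x` records the wins of `i` over `j` for `i < j`, and `j` wins the other
`N i j - x` comparisons. -/
def winMatrix (N : Matrix (Fin n) (Fin n) ℕ) (x : Pairing n → ℕ) : Matrix (Fin n) (Fin n) ℝ :=
  Matrix.of fun i j =>
    if h : i < j then (x ⟨(i, j), h⟩ : ℝ)
    else if h : j < i then (N j i : ℝ) - (x ⟨(j, i), h⟩ : ℝ)
    else 0

/-- The Bradley-Terry log-likelihood of the abilities `μ`, given the win counts `C` (up to an
additive constant that does not depend on `μ`). -/
def btLogLik (C : Matrix (Fin n) (Fin n) ℝ) (μ : Fin n → ℝ) : ℝ :=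
  ∑ i, ∑ j, C i j * Real.log (Real.sigmoid (μ i - μ j))

/-- `μ` is a maximum likelihood estimate of the abilities from the win counts `C`. -/
def IsBTEstimate (C : Matrix (Fin n) (Fin n) ℝ) (μ : Fin n → ℝ) : Prop :=
  ∀ ν, btLogLik C ν ≤ btLogLik C μ

/-- The score: the gradient of the log-likelihood in `μ`. -/
def btScore (C : Matrix (Fin n) (Fin n) ℝ) (μ : Fin n → ℝ) (a : Fin n) : ℝ :=
  fderiv ℝ (btLogLik C) μ (Pi.single a 1)

/-- The Fisher information: second moments of the score under the model. -/
def fisherInfo (N : Matrix (Fin n) (Fin n) ℕ) (μ : Fin n → ℝ) : Matrix (Fin n) (Fin n) ℝ :=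
  Matrix.of fun a b =>
    ∫ x, btScore (winMatrix N x) μ a * btScore (winMatrix N x) μ b ∂(btLaw N μ)

/-- The log-abilities normalized so that their exponentials sum to one, the normalization of the
influence weights. -/
def normalizedScores (μ : Fin n → ℝ) : Fin n → ℝ :=
  fun i => μ i - Real.log (∑ j, Real.exp (μ j))

/-- Abilities are determined only up to a common additive constant.  This is the Fisher information
of the identifiable parametrization in which the ability of player `0` is held fixed. -/
def refFisherInfo [NeZero n] (N : Matrix (Fin n) (Fin n) ℕ) (μ : Fin n → ℝ) :
    Matrix {a : Fin n // a ≠ 0} {a : Fin n // a ≠ 0} ℝ :=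
  (fisherInfo N μ).submatrix Subtype.val Subtype.val

/-- The asymptotic covariance of the maximum likelihood abilities when the ability of player `0`
is held fixed: the inverse Fisher information, bordered by zeros for player `0`. -/
def btRefCov [NeZero n] (N : Matrix (Fin n) (Fin n) ℕ) (μ : Fin n → ℝ) :
    Matrix (Fin n) (Fin n) ℝ :=
  Matrix.of fun a b =>
    if ha : a ≠ 0 then (if hb : b ≠ 0 then (refFisherInfo N μ)⁻¹ ⟨a, ha⟩ ⟨b, hb⟩ else 0) else 0

/-- The asymptotic covariance of the normalized Bradley-Terry log-abilities (which do not depend on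
the choice of the reference player). -/
def btAsymptoticCov [NeZero n] (N : Matrix (Fin n) (Fin n) ℕ) (μ : Fin n → ℝ) :
    Matrix (Fin n) (Fin n) ℝ :=
  jacobian normalizedScores μ * btRefCov N μ * (jacobian normalizedScores μ)ᵀ

/-- An estimator `T` of the normalized log-abilities is asymptotically efficient at `μ` if, for
`m → ∞` independent replicates of the schedule `N`, its `√m`-rescaled error is asymptotically
Gaussian, centred, with the inverse Fisher information as its covariance.  The two extra clauses say
that this covariance is not degenerate in the sense of a default value. -/
def IsAsymptoticallyEfficientAt [NeZero n] (N : Matrix (Fin n) (Fin n) ℕ)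
    (T : Matrix (Fin n) (Fin n) ℝ → Fin n → ℝ) (μ : Fin n → ℝ) : Prop :=
  IsUnit (refFisherInfo N μ).det ∧
  (btAsymptoticCov N μ).PosSemidef ∧
  TendstoInDistribution
    (fun (m : ℕ) (x : Pairing n → ℕ) =>
      WithLp.toLp 2 (√(m : ℝ) • (T (winMatrix (m • N) x) - normalizedScores μ)))
    atTop (id : EuclideanSpace ℝ (Fin n) → EuclideanSpace ℝ (Fin n))
    (fun m => btLaw (m • N) μ) (multivariateGaussian 0 (btAsymptoticCov N μ))

/-! ### The delta method -/

/-- The covariance matrix of the upper-triangular win counts. -/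
def winCov (N : Matrix (Fin n) (Fin n) ℕ) (μ : Fin n → ℝ) :
    Matrix (Pairing n) (Pairing n) ℝ :=
  Matrix.of fun p q =>
    covariance (fun x : Pairing n → ℕ => (x p : ℝ)) (fun x => (x q : ℝ)) (btLaw N μ)

/-- The log influence weight of the citation matrix `C` as a function of perturbations. -/
def perturbedLogIW (C : Matrix (Fin n) (Fin n) ℕ) (t : Pairing n → ℝ) : Fin n → ℝ :=
  logInfluenceWeight (perturb (C.map (fun c => (c : ℝ))) t)

/-- The delta-method covariance `J Σ Jᵀ` of the log influence weight at `C`: `J` is the Jacobian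
in the perturbations, and `Σ` is the covariance of independent binomial counts with
`C i j + C j i` trials and success probability `1/2` (equal abilities). -/
def deltaMethodCov (C : Matrix (Fin n) (Fin n) ℕ) : Matrix (Fin n) (Fin n) ℝ :=
  jacobian (perturbedLogIW C) 0 * winCov (C + Cᵀ) 0 * (jacobian (perturbedLogIW C) 0)ᵀ

/-! ### The circular tournament -/

/-- The circulant citation matrix with first column `(0, k, 0, …, 0, k)`. -/
def circleCitations (n k : ℕ) [NeZero n] : Matrix (Fin n) (Fin n) ℕ :=
  Matrix.circulant fun d : Fin n => if d = 1 ∨ d = -1 then k else 0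

end PairedComparison

end

noncomputable section

namespace PairedComparison

variable {n : ℕ}

/-! Let L be the Laplacian of the circular tournament, E the all-ones matrix, M = L + E, P the
projection onto zero-sum vectors, B the incidence matrix of players and pairings, and Σ the
covariance of the counts.

The balance equations Lw = 0 and the normalization merge into the single system Mw = 1, so near the
tournament w = M⁻¹1 is differentiable. At the uniform weight the derivative only sees the row and
column sums ±Bt of the perturbation, and the Jacobian of log w is 2M⁻¹B (`jacobian_perturbedLogIW`).
At equal abilities the Bradley-Terry score is B applied to the centred counts, so the Fisher
information is BΣBᵀ (`fisherInfo_const`). The two estimators meet in the identity BΣBᵀ = L/2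
(`incidence_mul_winCov_mul_transpose`): the delta method gives 4M⁻¹(L/2)M⁻ᵀ, the inverse information
projected by P gives the pseudo-inverse of L/2, and both are twice the pseudo-inverse of L. On the
cycle this pseudo-inverse is an explicit quadratic in the distance
(`influenceLaplacian_mul_greenMatrix`), whence the formula in d.

For efficiency, w is unchanged by scaling, so m replicates amount to a perturbation of one
tournament by the centred counts divided by m. Characteristic functions then suffice: those of the
counts are products of powers of cosines (`tendsto_integral_exp_centredWins`), and replacing log w
by its linearization costs nothing in the limit (`tendsto_integral_exp_sub_delta`). -/

/-! ### Influence weights as solutions of a nonsingular linear system -/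

/-- The Laplacian of a citation matrix: `(influenceLaplacian C *ᵥ w) i` is the difference of the
two sides of the balance equation for player `i`. -/
def influenceLaplacian (C : Matrix (Fin n) (Fin n) ℝ) : Matrix (Fin n) (Fin n) ℝ :=
  Matrix.diagonal (fun i => ∑ j, C j i) - C

/-- The Laplacian with the all-ones matrix added, which is invertible at connected tournaments. -/
def groundedLaplacian (C : Matrix (Fin n) (Fin n) ℝ) : Matrix (Fin n) (Fin n) ℝ :=
  influenceLaplacian C + Matrix.of fun _ _ => 1

/-- The orthogonal projection onto the vectors with zero sum. -/
def centering (n : ℕ) : Matrix (Fin n) (Fin n) ℝ :=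
  1 - Matrix.of fun _ _ => 1 / (n : ℝ)

lemma influenceLaplacian_mulVec (C : Matrix (Fin n) (Fin n) ℝ) (w : Fin n → ℝ) (i : Fin n) :
    (influenceLaplacian C *ᵥ w) i = (∑ j, C j i) * w i - ∑ j, w j * C i j := by
  simp only [influenceLaplacian, sub_mulVec, Pi.sub_apply, mulVec_diagonal]
  simp [mulVec, dotProduct, mul_comm]

lemma sum_influenceLaplacian_mulVec (C : Matrix (Fin n) (Fin n) ℝ) (w : Fin n → ℝ) :
    ∑ i, (influenceLaplacian C *ᵥ w) i = 0 := by
  simp only [influenceLaplacian_mulVec, Finset.sum_sub_distrib, Finset.sum_mul]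
  rw [sub_eq_zero, Finset.sum_comm]
  simp [mul_comm]

lemma groundedLaplacian_mulVec (C : Matrix (Fin n) (Fin n) ℝ) (w : Fin n → ℝ) (i : Fin n) :
    (groundedLaplacian C *ᵥ w) i = (influenceLaplacian C *ᵥ w) i + ∑ j, w j := by
  rw [groundedLaplacian, add_mulVec]
  simp [mulVec, dotProduct]

/-- Columns of L sum to zero, so adding up the entries of Mw = 1 leaves n ∑ w = n. This recovers the
normalization, and then Lw = 0. -/
lemma isInfluenceWeight_iff_groundedLaplacian [NeZero n] {C : Matrix (Fin n) (Fin n) ℝ}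
    (hC : ∀ i, ∑ j, C j i ≠ 0) (w : Fin n → ℝ) :
    IsInfluenceWeight C w ↔ groundedLaplacian C *ᵥ w = 1 := by
  have key : IsInfluenceWeight C w ↔ (influenceLaplacian C *ᵥ w = 0 ∧ ∑ i, w i = 1) := by
    unfold IsInfluenceWeight
    constructor
    · rintro ⟨-, h, h1⟩
      refine ⟨funext fun i => ?_, h1⟩
      have := h i
      rw [eq_div_iff (hC i)] at this
      rw [influenceLaplacian_mulVec, Pi.zero_apply]
      linarith
    · rintro ⟨h, h1⟩
      refine ⟨hC, fun i => ?_, h1⟩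
      have := congrFun h i
      rw [influenceLaplacian_mulVec, Pi.zero_apply] at this
      rw [eq_div_iff (hC i)]
      linarith
  rw [key]
  constructor
  · rintro ⟨h, h1⟩
    ext i
    simp [groundedLaplacian_mulVec, h, h1]
  · intro h
    have hn : (n : ℝ) ≠ 0 := NeZero.ne _
    have h1 : ∑ i, w i = 1 := by
      have : ∑ i, (groundedLaplacian C *ᵥ w) i = n := by simp [h]
      simp only [groundedLaplacian_mulVec, Finset.sum_add_distrib,
        sum_influenceLaplacian_mulVec] at this
      simpa [hn] using this
    refine ⟨funext fun i => ?_, h1⟩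
    have := congrFun h i
    rw [groundedLaplacian_mulVec, h1] at this
    simpa using this

lemma isInfluenceWeight_iff_eq_inv [NeZero n] {C : Matrix (Fin n) (Fin n) ℝ}
    (hC : ∀ i, ∑ j, C j i ≠ 0) (hM : IsUnit (groundedLaplacian C)) (w : Fin n → ℝ) :
    IsInfluenceWeight C w ↔ w = (groundedLaplacian C)⁻¹ *ᵥ 1 := by
  have hd := (isUnit_iff_isUnit_det _).1 hM
  rw [isInfluenceWeight_iff_groundedLaplacian hC]
  constructor
  · rintro h
    rw [← h, mulVec_mulVec, nonsing_inv_mul _ hd, one_mulVec]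
  · rintro rfl
    rw [mulVec_mulVec, mul_nonsing_inv _ hd, one_mulVec]

lemma influenceWeight_eq_inv_mulVec [NeZero n] {C : Matrix (Fin n) (Fin n) ℝ}
    (hC : ∀ i, ∑ j, C j i ≠ 0) (hM : IsUnit (groundedLaplacian C)) :
    influenceWeight C = (groundedLaplacian C)⁻¹ *ᵥ 1 := by
  have h : ∃! w, IsInfluenceWeight C w := by
    simp_rw [isInfluenceWeight_iff_eq_inv hC hM]
    exact existsUnique_eq
  rw [influenceWeight, dif_pos h]
  exact (isInfluenceWeight_iff_eq_inv hC hM _).1 h.choose_spec.1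

/-- An equality of predicates rather than an equivalence, so that it can be rewritten inside the
choice that defines `influenceWeight`. -/
lemma isInfluenceWeight_smul {c : ℝ} (hc : c ≠ 0) (C : Matrix (Fin n) (Fin n) ℝ) :
    IsInfluenceWeight (c • C) = IsInfluenceWeight C := by
  ext w
  have h1 : ∀ i, ∑ j, (c • C) j i = c * ∑ j, C j i := fun i => by simp [Finset.mul_sum]
  have h2 : ∀ i, ∑ j, w j * (c • C) i j = c * ∑ j, w j * C i j := fun i => by
    simp [Finset.mul_sum, mul_left_comm]
  simp only [IsInfluenceWeight, h1, h2, mul_div_mul_left _ _ hc, ne_eq, mul_eq_zero, hc, false_or]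

lemma logInfluenceWeight_smul {c : ℝ} (hc : c ≠ 0) (C : Matrix (Fin n) (Fin n) ℝ) :
    logInfluenceWeight (c • C) = logInfluenceWeight C := by
  have h : influenceWeight (c • C) = influenceWeight C := by
    classical
    exact congrArg (fun P : (Fin n → ℝ) → Prop => if h : ∃! w, P w then h.choose else 0)
      (isInfluenceWeight_smul hc C)
  unfold logInfluenceWeight
  rw [h]

/-! ### The Laplacian of the circular tournament -/

/-- The real citation matrix of the circular tournament. -/
def circleMatrix (n k : ℕ) [NeZero n] : Matrix (Fin n) (Fin n) ℝ :=
  (circleCitations n k).map (fun c => (c : ℝ))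

/-- The pseudo-inverse of the Laplacian of the cycle, as a function of the distance. -/
def cycleGreen (n : ℕ) (x : ℝ) : ℝ := ((n : ℝ) ^ 2 - 1 - 6 * x * (n - x)) / (12 * n)

/-- The pseudo-inverse of the Laplacian of the cycle. -/
def greenMatrix (n : ℕ) : Matrix (Fin n) (Fin n) ℝ :=
  Matrix.of fun a b => cycleGreen n |(a : ℝ) - (b : ℝ)|

lemma fin_one_ne_neg_one [NeZero n] (hn : 3 ≤ n) : (1 : Fin n) ≠ -1 := by
  obtain ⟨m, rfl⟩ : ∃ m, n = m + 3 := ⟨n - 3, by omega⟩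
  intro h
  have := congrArg Fin.val h
  rw [Fin.val_neg] at this
  simp at this

lemma circleMatrix_apply [NeZero n] (hn : 3 ≤ n) (k : ℕ) (i j : Fin n) :
    circleMatrix n k i j = (if j = i - 1 then (k : ℝ) else 0) + (if j = i + 1 then (k : ℝ) else 0) := by
  have h1 : i - j = 1 ↔ j = i - 1 := by
    rw [sub_eq_iff_eq_add, eq_sub_iff_add_eq, add_comm, eq_comm, add_comm]
  have h2 : i - j = -1 ↔ j = i + 1 := by
    rw [← neg_inj, neg_sub, neg_neg, sub_eq_iff_eq_add, add_comm]
  have h3 : i - 1 ≠ i + 1 := fun h => fin_one_ne_neg_one hn (by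
    rw [sub_eq_add_neg] at h; exact (add_left_cancel h).symm)
  simp only [circleMatrix, circleCitations, map_apply, circulant_apply, h1, h2]
  by_cases ha : j = i - 1
  · simp [ha, h3]
  · simp [ha]

lemma circleMatrix_symm [NeZero n] (hn : 3 ≤ n) (k : ℕ) (i j : Fin n) :
    circleMatrix n k i j = circleMatrix n k j i := by
  rw [circleMatrix_apply hn, circleMatrix_apply hn, add_comm]
  congr 2 <;> grind

lemma sum_circleMatrix_mul [NeZero n] (hn : 3 ≤ n) (k : ℕ) (i : Fin n) (f : Fin n → ℝ) :
    ∑ j, circleMatrix n k i j * f j = k * (f (i - 1) + f (i + 1)) := by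
  simp [circleMatrix_apply hn, add_mul, Finset.sum_add_distrib, mul_add]

lemma sum_circleMatrix_col [NeZero n] (hn : 3 ≤ n) (k : ℕ) (i : Fin n) :
    ∑ j, circleMatrix n k j i = 2 * k := by
  have := sum_circleMatrix_mul hn k i 1
  simp only [Pi.one_apply, mul_one] at this
  simp_rw [circleMatrix_symm hn k _ i, this]
  ring

/-- x(n - x) is invariant under x ↦ n - x, so the distance may be replaced by the difference modulo
n: the matrix is circulant. -/
lemma greenMatrix_apply_sub [NeZero n] (a b : Fin n) :
    greenMatrix n a b = cycleGreen n ((a - b : Fin n) : ℕ) := by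
  have hb := b.isLt
  have ha := a.isLt
  simp only [greenMatrix, of_apply]
  rcases le_or_gt b a with h | h
  · rw [Fin.sub_val_of_le h, Nat.cast_sub h, abs_of_nonneg]
    exact sub_nonneg.2 (by exact_mod_cast h)
  · have hv : ((a - b : Fin n) : ℕ) = n - b + a := by
      rw [Fin.sub_def]
      exact Nat.mod_eq_of_lt (by have := Fin.lt_def.1 h; omega)
    rw [hv, Nat.cast_add, Nat.cast_sub hb.le, abs_of_neg (sub_neg.2 (by exact_mod_cast h))]
    unfold cycleGreen
    ring

lemma cycleGreen_add_one [NeZero n] (hn : 3 ≤ n) (v : Fin n) :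
    cycleGreen n ((v + 1 : Fin n) : ℕ) = cycleGreen n ((v : ℕ) + 1) := by
  obtain ⟨m, rfl⟩ : ∃ m, n = m + 1 := ⟨n - 1, by omega⟩
  -- At the wrap-around, the quadratic takes the same value at n as at 0.
  rcases eq_or_ne v (Fin.last m) with rfl | h
  · simp [cycleGreen]
  · rw [Fin.val_add_one_of_lt (Fin.lt_last_iff_ne_last.2 h)]
    push_cast; rfl

lemma cycleGreen_sub_one [NeZero n] (hn : 3 ≤ n) {v : Fin n} (hv : v ≠ 0) :
    cycleGreen n ((v - 1 : Fin n) : ℕ) = cycleGreen n ((v : ℕ) - 1) := by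
  obtain ⟨m, rfl⟩ : ∃ m, n = m + 1 := ⟨n - 1, by omega⟩
  have : (v : ℕ) ≠ 0 := fun h => hv (Fin.ext (by simpa using h))
  have h : ((v - 1 : Fin (m + 1)) : ℕ) = v - 1 := by
    rw [Fin.val_sub_one_of_ne_zero hv]
  rw [h, Nat.cast_sub (by omega), Nat.cast_one]

/-- The quadratic has leading coefficient 1/(2n), hence constant second difference 1/n, which gives
-1/n off the diagonal. At distance 0 both neighbours have the value at 1, and the kink supplies the
additional 1. -/
lemma influenceLaplacian_mul_greenMatrix [NeZero n] (hn : 3 ≤ n) (k : ℕ) :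
    influenceLaplacian (circleMatrix n k) * greenMatrix n = (k : ℝ) • centering n := by
  have hn0 : (n : ℝ) ≠ 0 := NeZero.ne _
  ext a b
  have h1 : (influenceLaplacian (circleMatrix n k) * greenMatrix n) a b =
      (influenceLaplacian (circleMatrix n k) *ᵥ fun c => greenMatrix n c b) a := rfl
  have h2 : ∑ j, greenMatrix n j b * circleMatrix n k a j =
      k * (greenMatrix n (a - 1) b + greenMatrix n (a + 1) b) := by
    rw [← sum_circleMatrix_mul hn k a fun j => greenMatrix n j b]
    simp only [mul_comm]
  rw [h1, influenceLaplacian_mulVec, h2, sum_circleMatrix_col hn, greenMatrix_apply_sub,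
    greenMatrix_apply_sub, greenMatrix_apply_sub, show a - 1 - b = a - b - 1 by abel,
    show a + 1 - b = a - b + 1 by abel, cycleGreen_add_one hn]
  simp only [centering, Matrix.smul_apply, Matrix.sub_apply, of_apply, one_apply,
    ← sub_eq_zero (a := a) (b := b)]
  generalize a - b = v
  rcases eq_or_ne v 0 with rfl | hv
  · have h3 : (((0 : Fin n) - 1 : Fin n) : ℕ) = n - 1 := by
      obtain ⟨m, rfl⟩ : ∃ m, n = m + 1 := ⟨n - 1, by omega⟩
      simp
    rw [h3, Nat.cast_sub (by omega)]
    simp only [cycleGreen, if_true, smul_eq_mul, Fin.val_zero]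
    field_simp
    push_cast
    ring
  · rw [cycleGreen_sub_one hn hv]
    simp only [cycleGreen, hv, if_false, smul_eq_mul]
    field_simp
    ring

lemma greenMatrix_symm (a b : Fin n) : greenMatrix n a b = greenMatrix n b a := by
  simp [greenMatrix, abs_sub_comm]

/-- The constant n² - 1 in the quadratic is the one that makes this sum vanish. -/
lemma sum_greenMatrix_col [NeZero n] (b : Fin n) : ∑ a, greenMatrix n a b = 0 := by
  have hn0 : (n : ℝ) ≠ 0 := NeZero.ne _
  simp_rw [greenMatrix_apply_sub]
  have h1 := Equiv.sum_comp (Equiv.subRight b) fun v : Fin n => cycleGreen n (v : ℕ)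
  simp only [Equiv.subRight_apply] at h1
  rw [h1, Fin.sum_univ_eq_sum_range fun v => cycleGreen n (v : ℝ)]
  -- The parameter c is kept apart from the length m so that induction on m applies; c = m = n is
  -- substituted afterwards.
  have h2 : ∀ (c : ℝ) (m : ℕ), ∑ v ∈ Finset.range m, (c ^ 2 - 1 - 6 * (v : ℝ) * (c - v)) =
      m * (c ^ 2 - 1) - 3 * c * m * (m - 1) + m * (m - 1) * (2 * m - 1) := by
    intro c m
    induction m with
    | zero => simp
    | succ m ih => rw [Finset.sum_range_succ, ih]; push_cast; ring
  unfold cycleGreen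
  rw [← Finset.sum_div, h2]
  field_simp
  ring

lemma centering_symm (a b : Fin n) : centering n a b = centering n b a := by
  simp [centering, one_apply, eq_comm]

lemma groundedLaplacian_mul_greenMatrix [NeZero n] (hn : 3 ≤ n) (k : ℕ) :
    groundedLaplacian (circleMatrix n k) * greenMatrix n = (k : ℝ) • centering n := by
  rw [groundedLaplacian, add_mul, influenceLaplacian_mul_greenMatrix hn]
  have : (Matrix.of fun _ _ => (1 : ℝ)) * greenMatrix n = 0 := by
    ext a b
    simp [mul_apply, sum_greenMatrix_col]
  rw [this, add_zero]

lemma influenceLaplacian_circleMatrix_mulVec_const [NeZero n] (hn : 3 ≤ n) (k : ℕ) (c : ℝ) :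
    influenceLaplacian (circleMatrix n k) *ᵥ (fun _ => c) = 0 := by
  ext i
  have := sum_circleMatrix_mul hn k i fun _ => c
  simp only [influenceLaplacian_mulVec, sum_circleMatrix_col hn, mul_comm c, this, Pi.zero_apply]
  ring

lemma groundedLaplacian_circleMatrix_mulVec_const [NeZero n] (hn : 3 ≤ n) (k : ℕ) :
    groundedLaplacian (circleMatrix n k) *ᵥ (fun _ => 1 / (n : ℝ)) = 1 := by
  ext i
  rw [groundedLaplacian_mulVec, influenceLaplacian_circleMatrix_mulVec_const hn]
  simp

lemma isUnit_groundedLaplacian_circleMatrix [NeZero n] (hn : 3 ≤ n) {k : ℕ} (hk : 1 ≤ k) :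
    IsUnit (groundedLaplacian (circleMatrix n k)) := by
  have hk0 : (k : ℝ) ≠ 0 := by positivity
  have hn0 : (n : ℝ) ≠ 0 := NeZero.ne _
  -- G/k inverts M on zero-sum vectors; M acts on constants as n, so E/n² inverts it there.
  refine IsUnit.of_mul_eq_one ((k : ℝ)⁻¹ • greenMatrix n + Matrix.of fun _ _ => 1 / (n : ℝ) ^ 2) ?_
  rw [mul_add, Matrix.mul_smul, groundedLaplacian_mul_greenMatrix hn, smul_smul,
    inv_mul_cancel₀ hk0, one_smul]
  have : groundedLaplacian (circleMatrix n k) * (Matrix.of fun _ _ => 1 / (n : ℝ) ^ 2) =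
      Matrix.of fun _ _ => 1 / (n : ℝ) := by
    ext a b
    have h1 := congrFun (groundedLaplacian_circleMatrix_mulVec_const hn k) a
    simp only [mulVec, dotProduct, mul_apply, of_apply, Pi.one_apply, ← Finset.sum_mul] at h1 ⊢
    calc _ = (∑ j, groundedLaplacian (circleMatrix n k) a j) * (1 / n) * (1 / n) := by
          field_simp
      _ = _ := by rw [h1, one_mul]
  rw [this, centering, sub_add_cancel]

lemma groundedLaplacian_transpose [NeZero n] (hn : 3 ≤ n) (k : ℕ) :
    (groundedLaplacian (circleMatrix n k))ᵀ = groundedLaplacian (circleMatrix n k) := by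
  have : (circleMatrix n k)ᵀ = circleMatrix n k := by
    ext a b; exact circleMatrix_symm hn k _ _
  rw [groundedLaplacian, influenceLaplacian, transpose_add, transpose_sub, this, diagonal_transpose]
  rfl

lemma centering_mul_groundedLaplacian [NeZero n] (k : ℕ) :
    centering n * groundedLaplacian (circleMatrix n k) =
      influenceLaplacian (circleMatrix n k) := by
  have hn0 : (n : ℝ) ≠ 0 := NeZero.ne _
  have h0 : ∀ b, ∑ j, influenceLaplacian (circleMatrix n k) j b = 0 := fun b => by
    have := sum_influenceLaplacian_mulVec (circleMatrix n k) (Pi.single b 1)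
    simpa using this
  ext a b
  rw [centering, sub_mul, one_mul, Matrix.sub_apply]
  simp [mul_apply, groundedLaplacian, ← Finset.mul_sum, Finset.sum_add_distrib, h0, hn0]

/-- With L = PM and M symmetric, the product collapses to M⁻¹P, and P = M(G/k). -/
lemma inv_groundedLaplacian_mul_influenceLaplacian [NeZero n] (hn : 3 ≤ n) {k : ℕ} (hk : 1 ≤ k) :
    (groundedLaplacian (circleMatrix n k))⁻¹ * influenceLaplacian (circleMatrix n k) *
      ((groundedLaplacian (circleMatrix n k))⁻¹)ᵀ = (k : ℝ)⁻¹ • greenMatrix n := by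
  have hk0 : (k : ℝ) ≠ 0 := by positivity
  have hd := (isUnit_iff_isUnit_det _).1 (isUnit_groundedLaplacian_circleMatrix hn hk)
  rw [transpose_nonsing_inv, groundedLaplacian_transpose hn, ← centering_mul_groundedLaplacian,
    Matrix.mul_assoc, Matrix.mul_assoc, mul_nonsing_inv _ hd, Matrix.mul_one]
  have : centering n = groundedLaplacian (circleMatrix n k) * ((k : ℝ)⁻¹ • greenMatrix n) := by
    rw [Matrix.mul_smul, groundedLaplacian_mul_greenMatrix hn, smul_smul, inv_mul_cancel₀ hk0,
      one_smul]
  rw [this, ← Matrix.mul_assoc, nonsing_inv_mul _ hd, Matrix.one_mul]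

/-! ### The Jacobian of the log influence weight -/

/-- The incidence matrix of players and pairings. -/
def incidence (n : ℕ) : Matrix (Fin n) (Pairing n) ℝ :=
  Matrix.of fun a p => (if a = p.1.1 then 1 else 0) - (if a = p.1.2 then 1 else 0)

/-- The linear part of `perturb`. -/
def perturbLinear (n : ℕ) : (Pairing n → ℝ) →ₗ[ℝ] Matrix (Fin n) (Fin n) ℝ :=
  ∑ p : Pairing n, (LinearMap.proj p : (Pairing n → ℝ) →ₗ[ℝ] ℝ).smulRight
    (Matrix.single p.1.1 p.1.2 (1 : ℝ) - Matrix.single p.1.2 p.1.1 (1 : ℝ))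

lemma perturb_eq (C : Matrix (Fin n) (Fin n) ℝ) (t : Pairing n → ℝ) :
    perturb C t = C + perturbLinear n t := by
  simp [perturb, perturbLinear, LinearMap.sum_apply]

/-- The Laplacian as a linear map. -/
def laplacianLinear (n : ℕ) : Matrix (Fin n) (Fin n) ℝ →ₗ[ℝ] Matrix (Fin n) (Fin n) ℝ where
  toFun := influenceLaplacian
  map_add' A B := by
    ext i j
    simp only [influenceLaplacian, Matrix.sub_apply, Matrix.add_apply, diagonal_apply,
      Finset.sum_add_distrib]
    split_ifs <;> ring
  map_smul' c A := by
    ext i j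
    simp only [influenceLaplacian, Matrix.sub_apply, Matrix.smul_apply, diagonal_apply,
      smul_eq_mul, ← Finset.mul_sum, RingHom.id_apply]
    split_ifs <;> ring

lemma groundedLaplacian_perturb (C : Matrix (Fin n) (Fin n) ℝ) (t : Pairing n → ℝ) :
    groundedLaplacian (perturb C t) =
      groundedLaplacian C + (laplacianLinear n ∘ₗ perturbLinear n) t := by
  have : influenceLaplacian (perturb C t) = influenceLaplacian C +
      (laplacianLinear n ∘ₗ perturbLinear n) t := by
    rw [perturb_eq]
    exact (laplacianLinear n).map_add _ _
  rw [groundedLaplacian, this, groundedLaplacian]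
  abel

lemma sum_perturbLinear_row (t : Pairing n → ℝ) (i : Fin n) :
    ∑ j, perturbLinear n t i j = (incidence n *ᵥ t) i := by
  simp only [perturbLinear, LinearMap.sum_apply, LinearMap.smulRight_apply, LinearMap.proj_apply,
    Matrix.sum_apply, Matrix.smul_apply, Matrix.sub_apply, single_apply, smul_eq_mul, mulVec,
    dotProduct, incidence, of_apply]
  rw [Finset.sum_comm]
  refine Finset.sum_congr rfl fun p _ => ?_
  rw [← Finset.mul_sum, mul_comm]
  simp [Finset.sum_sub_distrib, ite_and, eq_comm]

lemma perturbLinear_antisymm (t : Pairing n → ℝ) (i j : Fin n) :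
    perturbLinear n t i j = -perturbLinear n t j i := by
  simp only [perturbLinear, LinearMap.sum_apply, LinearMap.smulRight_apply, LinearMap.proj_apply,
    Matrix.sum_apply, Matrix.smul_apply, Matrix.sub_apply, single_apply, smul_eq_mul]
  rw [← Finset.sum_neg_distrib]
  refine Finset.sum_congr rfl fun p _ => ?_
  rw [← mul_neg, neg_sub]
  simp only [and_comm]

lemma sum_perturbLinear_col (t : Pairing n → ℝ) (i : Fin n) :
    ∑ j, perturbLinear n t j i = -(incidence n *ᵥ t) i := by
  simp_rw [perturbLinear_antisymm t _ i, Finset.sum_neg_distrib, sum_perturbLinear_row]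

lemma perturbLinear_apply_of_lt (t : Pairing n → ℝ) {i j : Fin n} (h : i < j) :
    perturbLinear n t i j = t ⟨(i, j), h⟩ := by
  simp only [perturbLinear, LinearMap.sum_apply, LinearMap.smulRight_apply, LinearMap.proj_apply,
    Matrix.sum_apply, Matrix.smul_apply, Matrix.sub_apply, single_apply, smul_eq_mul]
  rw [Finset.sum_eq_single ⟨(i, j), h⟩]
  · simp [h.ne']
  · rintro ⟨⟨a, b⟩, hab⟩ - hne
    have h1 : ¬(a = i ∧ b = j) := fun h' => hne (by simp [h'])
    have h2 : ¬(b = i ∧ a = j) := by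
      rintro ⟨rfl, rfl⟩
      exact lt_asymm h hab
    simp [h1, h2]
  · simp

/-- On constants the Laplacian is column sum minus row sum, and these are opposite for an
antisymmetric perturbation; hence the factor -2. -/
lemma laplacianLinear_perturbLinear_mulVec_const (t : Pairing n → ℝ) (c : ℝ) :
    (laplacianLinear n ∘ₗ perturbLinear n) t *ᵥ (fun _ => c) =
      (-2 * c) • (incidence n *ᵥ t) := by
  ext i
  have h1 : (laplacianLinear n ∘ₗ perturbLinear n) t = influenceLaplacian (perturbLinear n t) := rfl
  rw [h1, influenceLaplacian_mulVec, ← Finset.mul_sum, sum_perturbLinear_row,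
    sum_perturbLinear_col]
  simp only [Pi.smul_apply, smul_eq_mul]
  ring

section
-- A submultiplicative norm makes the matrices a Banach algebra, where units are open and inversion
-- is differentiable. The lemma below mentions only vectors in its derivative, so the norm can stay
-- local.
attribute [local instance] Matrix.linftyOpNormedRing Matrix.linftyOpNormedAlgebra

lemma hasFDerivAt_inv_mulVec_one (M : Matrix (Fin n) (Fin n) ℝ) (hM : IsUnit M)
    (Φ : (Pairing n → ℝ) →ₗ[ℝ] Matrix (Fin n) (Fin n) ℝ) :
    (∀ᶠ t in 𝓝 (0 : Pairing n → ℝ), IsUnit (M + Φ t)) ∧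
    ∀ v : Fin n → ℝ, ∃ D : (Pairing n → ℝ) →L[ℝ] (Fin n → ℝ),
      (∀ t, D t = -(M⁻¹ *ᵥ (Φ t *ᵥ (M⁻¹ *ᵥ v)))) ∧
      HasFDerivAt (fun t => (M + Φ t)⁻¹ *ᵥ v) D 0 := by
  obtain ⟨u, rfl⟩ := hM
  have hc : Continuous Φ := Φ.continuous_of_finiteDimensional
  constructor
  · have h1 : Tendsto (fun t => (u : Matrix (Fin n) (Fin n) ℝ) + Φ t) (𝓝 0) (𝓝 u) := by
      have : Continuous fun t => (u : Matrix (Fin n) (Fin n) ℝ) + Φ t := by fun_prop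
      simpa using this.tendsto 0
    exact h1.eventually (Units.nhds u)
  · intro v
    let Ψ : (Pairing n → ℝ) →L[ℝ] Matrix (Fin n) (Fin n) ℝ := ⟨Φ, hc⟩
    let E : Matrix (Fin n) (Fin n) ℝ →L[ℝ] (Fin n → ℝ) :=
      LinearMap.toContinuousLinearMap ((Matrix.mulVecBilin ℝ ℝ).flip v)
    have h0 : HasFDerivAt (fun t => (u : Matrix (Fin n) (Fin n) ℝ) + Φ t) Ψ 0 :=
      Ψ.hasFDerivAt.const_add _
    have h1 : HasFDerivAt Ring.inverse (-ContinuousLinearMap.mulLeftRight ℝ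
        (Matrix (Fin n) (Fin n) ℝ) ↑u⁻¹ ↑u⁻¹) ((u : Matrix (Fin n) (Fin n) ℝ) + Φ 0) := by
      simpa using hasFDerivAt_ringInverse (𝕜 := ℝ) u
    have h3 := E.hasFDerivAt.comp (0 : Pairing n → ℝ) (h1.comp 0 h0)
    refine ⟨_, fun t => ?_, h3.congr_of_eventuallyEq (.of_forall fun t => ?_)⟩
    · change (-(((u⁻¹ : (Matrix (Fin n) (Fin n) ℝ)ˣ) : Matrix (Fin n) (Fin n) ℝ) * Φ t *
        ((u⁻¹ : (Matrix (Fin n) (Fin n) ℝ)ˣ) : Matrix (Fin n) (Fin n) ℝ))) *ᵥ v = _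
      simp [mulVec_mulVec, neg_mulVec, Matrix.mul_assoc]
    · simp [E, nonsing_inv_eq_ringInverse]

end

/-- The logarithm contributes 1/w = n, inversion a sign, and the constant vector 1/n the factor
-2/n: the product is 2. -/
lemma hasFDerivAt_perturbedLogIW [NeZero n] (hn : 3 ≤ n) {k : ℕ} (hk : 1 ≤ k) :
    ∃ D : (Pairing n → ℝ) →L[ℝ] (Fin n → ℝ),
      (∀ t, D t = ((2 : ℝ) • ((groundedLaplacian (circleMatrix n k))⁻¹ * incidence n)) *ᵥ t) ∧
      HasFDerivAt (perturbedLogIW (circleCitations n k)) D 0 := by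
  have hn0 : (n : ℝ) ≠ 0 := NeZero.ne _
  have hk0 : (k : ℝ) ≠ 0 := by positivity
  have hU := isUnit_groundedLaplacian_circleMatrix hn hk
  have hd := (isUnit_iff_isUnit_det _).1 hU
  obtain ⟨hev, h⟩ := hasFDerivAt_inv_mulVec_one (groundedLaplacian (circleMatrix n k)) hU
    (laplacianLinear n ∘ₗ perturbLinear n)
  obtain ⟨D, hD, hderiv⟩ := h 1
  have hw : (groundedLaplacian (circleMatrix n k))⁻¹ *ᵥ 1 = fun _ => 1 / (n : ℝ) := by
    rw [← groundedLaplacian_circleMatrix_mulVec_const hn k, mulVec_mulVec, nonsing_inv_mul _ hd,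
      one_mulVec]
  -- Column sums stay nonzero nearby; together with invertibility this keeps the weight unique, so
  -- its default value never occurs near 0.
  have hev2 : ∀ᶠ t in 𝓝 (0 : Pairing n → ℝ), ∀ i, ∑ j, perturb (circleMatrix n k) t j i ≠ 0 := by
    refine eventually_all.2 fun i => ?_
    have hcont : Continuous fun t => ∑ j, perturb (circleMatrix n k) t j i := by
      simp_rw [perturb_eq, Matrix.add_apply]
      have : Continuous (perturbLinear n) := LinearMap.continuous_of_finiteDimensional _
      fun_prop
    refine hcont.continuousAt.eventually_ne ?_
    simp [perturb_eq, sum_circleMatrix_col hn, hk0]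
  have heq : perturbedLogIW (circleCitations n k) =ᶠ[𝓝 0] fun t i =>
      Real.log (((groundedLaplacian (circleMatrix n k) +
        (laplacianLinear n ∘ₗ perturbLinear n) t)⁻¹ *ᵥ 1) i) := by
    filter_upwards [hev, hev2] with t ht ht2
    rw [← groundedLaplacian_perturb] at ht ⊢
    rw [← influenceWeight_eq_inv_mulVec ht2 ht]
    rfl
  refine ⟨(n : ℝ) • D, fun t => ?_, ?_⟩
  · rw [_root_.smul_apply, hD, hw, laplacianLinear_perturbLinear_mulVec_const,
      mulVec_smul, mulVec_mulVec, smul_mulVec, ← neg_smul, smul_smul]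
    congr 1
    field_simp
  · refine HasFDerivAt.congr_of_eventuallyEq (hasFDerivAt_pi'.2 fun i => ?_) heq
    have h1 := (hasFDerivAt_pi'.1 hderiv i).log (by simp [hw, hn0])
    refine h1.congr_fderiv ?_
    ext t
    simp [hw]

lemma perturbedLogIW_zero [NeZero n] (hn : 3 ≤ n) {k : ℕ} (hk : 1 ≤ k) :
    perturbedLogIW (circleCitations n k) 0 = fun _ => -Real.log n := by
  have hk0 : (k : ℝ) ≠ 0 := by positivity
  have hU := isUnit_groundedLaplacian_circleMatrix hn hk
  have hd := (isUnit_iff_isUnit_det _).1 hU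
  ext i
  have : perturbedLogIW (circleCitations n k) 0 = logInfluenceWeight (circleMatrix n k) := by
    simp [perturbedLogIW, perturb, circleMatrix]
  rw [this, logInfluenceWeight, influenceWeight_eq_inv_mulVec
    (fun i => by simp [sum_circleMatrix_col hn, hk0]) hU,
    ← groundedLaplacian_circleMatrix_mulVec_const hn k, mulVec_mulVec, nonsing_inv_mul _ hd,
      one_mulVec]
  simp

lemma jacobian_perturbedLogIW [NeZero n] (hn : 3 ≤ n) {k : ℕ} (hk : 1 ≤ k) :
    jacobian (perturbedLogIW (circleCitations n k)) 0 =
      (2 : ℝ) • ((groundedLaplacian (circleMatrix n k))⁻¹ * incidence n) := by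
  obtain ⟨D, hD, h⟩ := hasFDerivAt_perturbedLogIW hn hk
  ext a p
  rw [jacobian, of_apply, h.fderiv, hD]
  simp

lemma isInfluenceWeight_circle_iff [NeZero n] (hn : 3 ≤ n) {k : ℕ} (hk : 1 ≤ k) (w : Fin n → ℝ) :
    IsInfluenceWeight (circleMatrix n k) w ↔ w = fun _ => 1 / (n : ℝ) := by
  have hk0 : (k : ℝ) ≠ 0 := by positivity
  have hU := isUnit_groundedLaplacian_circleMatrix hn hk
  have hd := (isUnit_iff_isUnit_det _).1 hU
  rw [isInfluenceWeight_iff_eq_inv (fun i => by simp [sum_circleMatrix_col hn, hk0]) hU,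
    ← groundedLaplacian_circleMatrix_mulVec_const hn k, mulVec_mulVec, nonsing_inv_mul _ hd,
      one_mulVec]

/-! ### Moments of the win counts -/

lemma ae_le_btLaw (N : Matrix (Fin n) (Fin n) ℕ) (μ : Fin n → ℝ) :
    ∀ᵐ x ∂(btLaw N μ), ∀ p : Pairing n, x p ≤ N p.1.1 p.1.2 := by
  refine ae_all_iff.2 fun p => ?_
  have h : HasLaw (id : ℕ → ℕ) (binomial (N p.1.1 p.1.2)
      (unitInterval.sigmoid (μ p.1.1 - μ p.1.2))) (binomial (N p.1.1 p.1.2)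
      (unitInterval.sigmoid (μ p.1.1 - μ p.1.2))) := ⟨aemeasurable_id, Measure.map_id⟩
  exact (measurePreserving_eval (fun p : Pairing n => binomial (N p.1.1 p.1.2)
    (unitInterval.sigmoid (μ p.1.1 - μ p.1.2))) p).quasiMeasurePreserving.ae
      (ae_le_of_hasLaw_binomial h)

/-- The counts almost surely lie in a finite box, on which every function is bounded. This settles
all integrability questions below. -/
lemma memLp_btLaw (N : Matrix (Fin n) (Fin n) ℕ) (μ : Fin n → ℝ) (q : ENNReal) {E : Type*}
    [NormedAddCommGroup E] (f : (Pairing n → ℕ) → E) : MemLp f q (btLaw N μ) := by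
  have hfin : (Set.Iic fun p : Pairing n => N p.1.1 p.1.2).Finite := Set.finite_Iic _
  obtain ⟨C, hC⟩ := (hfin.image fun x => ‖f x‖).bddAbove
  refine MemLp.of_bound ?_ C ?_
  · exact (StronglyMeasurable.of_discrete).aestronglyMeasurable
  · filter_upwards [ae_le_btLaw N μ] with x hx
    exact hC ⟨x, hx, rfl⟩

lemma integrable_btLaw (N : Matrix (Fin n) (Fin n) ℕ) (μ : Fin n → ℝ) {E : Type*}
    [NormedAddCommGroup E] (f : (Pairing n → ℕ) → E) : Integrable f (btLaw N μ) :=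
  memLp_one_iff_integrable.1 (memLp_btLaw N μ 1 f)

/-- The binomial moments here and below are the classical identities for Bernstein polynomials,
evaluated at p. -/
lemma integral_binomial_id (N : ℕ) (p : unitInterval) :
    ∫ x, (x : ℝ) ∂(binomial N p) = N * p := by
  have h := congrArg (Polynomial.eval (p : ℝ)) (bernsteinPolynomial.sum_smul ℝ N)
  simp only [Polynomial.eval_finsetSum, bernsteinPolynomial,
    Polynomial.eval_mul, Polynomial.eval_natCast, Polynomial.eval_pow, Polynomial.eval_X,
    Polynomial.eval_sub, Polynomial.eval_one, nsmul_eq_mul] at h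
  rw [integral_binomial, ← h, Nat.range_succ_eq_Iic]
  exact Finset.sum_congr rfl fun k _ => by rw [smul_eq_mul, mul_comm]

lemma integral_binomial_sq (N : ℕ) (p : unitInterval) :
    ∫ x, ((x : ℝ) - N * p) ^ 2 ∂(binomial N p) = N * p * (1 - p) := by
  have h := congrArg (Polynomial.eval (p : ℝ)) (bernsteinPolynomial.variance ℝ N)
  simp only [Polynomial.eval_finsetSum, bernsteinPolynomial,
    Polynomial.eval_mul, Polynomial.eval_natCast, Polynomial.eval_pow, Polynomial.eval_X,
    Polynomial.eval_sub, Polynomial.eval_one, nsmul_eq_mul] at h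
  rw [integral_binomial, ← h, Nat.range_succ_eq_Iic]
  exact Finset.sum_congr rfl fun k _ => by rw [smul_eq_mul]; ring

lemma sigmoid_const (c : ℝ) : ((unitInterval.sigmoid (c - c) : unitInterval) : ℝ) = 1 / 2 := by
  rw [sub_self, one_div, ← Real.sigmoid_zero]
  rfl

/-- The win counts, centred at half of the number of comparisons. -/
def centredWins (N : Matrix (Fin n) (Fin n) ℕ) (x : Pairing n → ℕ) : Pairing n → ℝ :=
  fun p => (x p : ℝ) - N p.1.1 p.1.2 / 2

lemma integral_btLaw_eval (N : Matrix (Fin n) (Fin n) ℕ) (μ : Fin n → ℝ) (p : Pairing n)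
    (f : ℕ → ℝ) : ∫ x, f (x p) ∂(btLaw N μ) = ∫ m, f m ∂(binomial (N p.1.1 p.1.2)
      (unitInterval.sigmoid (μ p.1.1 - μ p.1.2))) :=
  integral_comp_eval (StronglyMeasurable.of_discrete).aestronglyMeasurable

lemma integral_centredWins_sq (N : Matrix (Fin n) (Fin n) ℕ) (c : ℝ) (p : Pairing n) :
    ∫ x, centredWins N x p ^ 2 ∂(btLaw N fun _ => c) = N p.1.1 p.1.2 / 4 := by
  have h := integral_btLaw_eval N (fun _ => c) p
    fun m => ((m : ℝ) - N p.1.1 p.1.2 * (1 / 2)) ^ 2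
  have h2 := integral_binomial_sq (N p.1.1 p.1.2) (unitInterval.sigmoid (c - c))
  rw [sigmoid_const] at h2
  rw [h2] at h
  simp only [centredWins]
  convert h using 1
  · simp [div_eq_mul_inv]
  · ring

lemma integral_btLaw_cast (N : Matrix (Fin n) (Fin n) ℕ) (c : ℝ) (p : Pairing n) :
    ∫ x, (x p : ℝ) ∂(btLaw N fun _ => c) = N p.1.1 p.1.2 / 2 := by
  rw [integral_btLaw_eval N _ p fun m => (m : ℝ), integral_binomial_id, sigmoid_const]
  ring

lemma winCov_eq (N : Matrix (Fin n) (Fin n) ℕ) (c : ℝ) :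
    winCov N (fun _ => c) = Matrix.diagonal fun p => (N p.1.1 p.1.2 : ℝ) / 4 := by
  ext p q
  rw [winCov, of_apply]
  rcases eq_or_ne p q with rfl | hpq
  · rw [diagonal_apply_eq, ← integral_centredWins_sq N c p]
    simp only [covariance, integral_btLaw_cast, centredWins, sq]
  · rw [diagonal_apply_ne _ hpq]
    refine IndepFun.covariance_eq_zero ?_ (memLp_btLaw _ _ _ _) (memLp_btLaw _ _ _ _)
    exact (iIndepFun_pi (X := fun (p : Pairing n) (m : ℕ) => (m : ℝ))
      fun p => (measurable_of_countable _).aemeasurable).indepFun hpq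

lemma integral_centredWins_mul (N : Matrix (Fin n) (Fin n) ℕ) (c : ℝ) (p q : Pairing n) :
    ∫ x, centredWins N x p * centredWins N x q ∂(btLaw N fun _ => c) = winCov N (fun _ => c) p q := by
  simp only [winCov, of_apply, covariance, integral_btLaw_cast, centredWins]

/-! ### The score and the Fisher information at equal abilities -/

/-- Links data to the perturbations of the delta method: the centre N/2 is the expected win matrix
at equal abilities. -/
lemma winMatrix_eq_perturb {N : Matrix (Fin n) (Fin n) ℕ} (hN : N.IsSymm) (hd : ∀ i, N i i = 0)
    (x : Pairing n → ℕ) :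
    winMatrix N x = perturb (Matrix.of fun i j => (N i j : ℝ) / 2) (centredWins N x) := by
  ext i j
  rw [perturb_eq, Matrix.add_apply, winMatrix, of_apply, of_apply]
  rcases lt_trichotomy i j with h | rfl | h
  · rw [dif_pos h, perturbLinear_apply_of_lt _ h]
    simp [centredWins]
  · have : perturbLinear n (centredWins N x) i i = 0 := by
      have := perturbLinear_antisymm (centredWins N x) i i
      linarith
    simp [this, hd]
  · rw [dif_neg h.not_gt, dif_pos h, perturbLinear_antisymm, perturbLinear_apply_of_lt _ h,
      ← hN.apply i j]
    simp only [centredWins]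
    ring

/-- The derivative of log σ at 0 is 1/2, so the score is half of wins minus losses. -/
lemma btScore_const (C : Matrix (Fin n) (Fin n) ℝ) (c : ℝ) (a : Fin n) :
    btScore C (fun _ => c) a = (∑ j, C a j - ∑ j, C j a) / 2 := by
  have hl : HasDerivAt (fun y => Real.log (Real.sigmoid y)) (1 / 2) (c - c) := by
    rw [sub_self]
    convert (Real.hasDerivAt_sigmoid 0).log (Real.sigmoid_pos 0).ne' using 1
    norm_num
  have h : HasFDerivAt (btLogLik C) (∑ i, ∑ j, C i j • ((1 / 2 : ℝ) •
      ((ContinuousLinearMap.proj i : (Fin n → ℝ) →L[ℝ] ℝ) - ContinuousLinearMap.proj j)))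
      (fun _ => c) := by
    unfold btLogLik
    refine HasFDerivAt.fun_sum fun i _ => HasFDerivAt.fun_sum fun j _ => ?_
    refine HasFDerivAt.const_mul ?_ _
    exact hl.comp_hasFDerivAt (f := fun μ : Fin n → ℝ => μ i - μ j) (fun _ => c)
      ((hasFDerivAt_apply i _).sub (hasFDerivAt_apply j _))
  rw [btScore, h.fderiv]
  simp only [_root_.sum_apply, _root_.smul_apply, _root_.sub_apply, ContinuousLinearMap.proj_apply,
    smul_eq_mul, mul_sub, Finset.sum_sub_distrib, Pi.single_apply, mul_ite, mul_one, mul_zero]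
  simp only [Finset.sum_ite_eq', Finset.mem_univ, if_true, sub_div, Finset.sum_div]
  rw [Finset.sum_comm]
  simp [div_eq_mul_inv]

lemma btScore_winMatrix {N : Matrix (Fin n) (Fin n) ℕ} (hN : N.IsSymm) (hd : ∀ i, N i i = 0)
    (x : Pairing n → ℕ) (c : ℝ) (a : Fin n) :
    btScore (winMatrix N x) (fun _ => c) a = (incidence n *ᵥ centredWins N x) a := by
  rw [btScore_const, winMatrix_eq_perturb hN hd, perturb_eq]
  simp only [Matrix.add_apply, Finset.sum_add_distrib, sum_perturbLinear_row,
    sum_perturbLinear_col, of_apply, hN.apply a]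
  ring

lemma fisherInfo_const {N : Matrix (Fin n) (Fin n) ℕ} (hN : N.IsSymm) (hd : ∀ i, N i i = 0)
    (c : ℝ) : fisherInfo N (fun _ => c) =
      incidence n * winCov N (fun _ => c) * (incidence n)ᵀ := by
  ext a b
  rw [fisherInfo, of_apply]
  simp only [btScore_winMatrix hN hd, mulVec, dotProduct, Finset.sum_mul_sum]
  rw [integral_finsetSum _ fun _ _ => integrable_btLaw _ _ _]
  simp only [mul_apply, transpose_apply, Finset.sum_mul]
  rw [Finset.sum_comm]
  refine Finset.sum_congr rfl fun p _ => ?_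
  rw [integral_finsetSum _ fun _ _ => integrable_btLaw _ _ _]
  refine Finset.sum_congr rfl fun q _ => ?_
  have : ∀ x, incidence n a p * centredWins N x p * (incidence n b q * centredWins N x q) =
      incidence n a p * incidence n b q * (centredWins N x p * centredWins N x q) :=
    fun x => by ring
  simp_rw [this]
  rw [integral_const_mul, integral_centredWins_mul]
  ring

/-! ### The circular schedule -/

/-- The numbers of comparisons in the circular tournament. -/
def circleSchedule (n k : ℕ) [NeZero n] : Matrix (Fin n) (Fin n) ℕ :=
  circleCitations n k + (circleCitations n k)ᵀ

lemma circleSchedule_isSymm [NeZero n] (k : ℕ) : (circleSchedule n k).IsSymm := by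
  simp [circleSchedule, Matrix.IsSymm, add_comm]

lemma circleSchedule_cast [NeZero n] (hn : 3 ≤ n) (k : ℕ) (i j : Fin n) :
    (circleSchedule n k i j : ℝ) = 2 * circleMatrix n k i j := by
  have := circleMatrix_symm hn k i j
  simp only [circleMatrix, map_apply] at this
  simp only [circleSchedule, circleMatrix, Matrix.add_apply, transpose_apply, map_apply,
    Nat.cast_add, ← this]
  ring

lemma circleSchedule_diag [NeZero n] (hn : 3 ≤ n) (k : ℕ) (i : Fin n) :
    circleSchedule n k i i = 0 := by
  have h0 : (0 : Fin n) ≠ 1 := by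
    obtain ⟨m, rfl⟩ : ∃ m, n = m + 2 := ⟨n - 2, by omega⟩
    exact zero_ne_one
  have h : circleCitations n k i i = 0 := by
    simp [circleCitations, h0, eq_comm (a := (0 : Fin n)) (b := -1)]
    omega
  simp [circleSchedule, h]

/-- The weighted Laplacian of a graph factors through its incidence matrix. The edge weights are the
variances 2c/4 = c/2. -/
lemma incidence_mul_winCov_mul_transpose [NeZero n] (hn : 3 ≤ n) (k : ℕ) (c : ℝ) :
    incidence n * winCov (circleSchedule n k) (fun _ => c) * (incidence n)ᵀ =
      (1 / 2 : ℝ) • influenceLaplacian (circleMatrix n k) := by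
  rw [winCov_eq]
  ext a b
  have h1 : (incidence n * Matrix.diagonal (fun p : Pairing n =>
      (circleSchedule n k p.1.1 p.1.2 : ℝ) / 4) * (incidence n)ᵀ) a b =
      (incidence n *ᵥ fun p =>
        (1 / 2 * circleMatrix n k p.1.1 p.1.2) * incidence n b p) a := by
    simp only [mul_apply (M := _ * _), mul_diagonal, transpose_apply, mulVec, dotProduct,
      circleSchedule_cast hn]
    exact Finset.sum_congr rfl fun p _ => by ring
  have hd : circleMatrix n k a a = 0 := by
    have := circleSchedule_cast hn k a a
    rw [circleSchedule_diag hn] at this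
    simpa using this
  -- Spreading the weights into an antisymmetric array turns the sum over pairings at a into a row
  -- sum over all j.
  have h2 : ∀ j, perturbLinear n (fun p =>
        (1 / 2 * circleMatrix n k p.1.1 p.1.2) * incidence n b p) a j =
      1 / 2 * circleMatrix n k a j * ((if b = a then 1 else 0) - (if b = j then 1 else 0)) := by
    intro j
    rcases lt_trichotomy a j with h | rfl | h
    · rw [perturbLinear_apply_of_lt _ h]
      simp [incidence]
    · rw [hd]
      have := perturbLinear_antisymm (fun p =>
        (1 / 2 * circleMatrix n k p.1.1 p.1.2) * incidence n b p) a a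
      linarith
    · rw [perturbLinear_antisymm, perturbLinear_apply_of_lt _ h, circleMatrix_symm hn k a j]
      simp only [incidence, of_apply]
      ring
  rw [h1, ← sum_perturbLinear_row]
  simp only [h2, mul_sub, Finset.sum_sub_distrib, ← Finset.sum_mul, ← Finset.mul_sum]
  have h3 := sum_circleMatrix_col hn k a
  simp_rw [circleMatrix_symm hn k _ a] at h3
  simp only [influenceLaplacian, Matrix.smul_apply, Matrix.sub_apply, diagonal_apply,
    sum_circleMatrix_col hn, h3, eq_comm (a := b) (b := a), smul_eq_mul]
  by_cases hab : a = b
  · simp [hab]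
    ring
  · simp [hab]

lemma deltaMethodCov_circle [NeZero n] (hn : 3 ≤ n) {k : ℕ} (hk : 1 ≤ k) :
    deltaMethodCov (circleCitations n k) = (2 / k : ℝ) • greenMatrix n := by
  have h := incidence_mul_winCov_mul_transpose hn k 0
  have h2 := inv_groundedLaplacian_mul_influenceLaplacian hn hk
  rw [deltaMethodCov, jacobian_perturbedLogIW hn hk]
  rw [show winCov (circleCitations n k + (circleCitations n k)ᵀ) 0 =
    winCov (circleSchedule n k) (fun _ => 0) from rfl]
  set A := (groundedLaplacian (circleMatrix n k))⁻¹
  set S := winCov (circleSchedule n k) (fun _ => 0)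
  have h3 : ((2 : ℝ) • (A * incidence n)) * S * ((2 : ℝ) • (A * incidence n))ᵀ =
      (4 : ℝ) • (A * (incidence n * S * (incidence n)ᵀ) * Aᵀ) := by
    simp only [transpose_smul, transpose_mul, Matrix.smul_mul, Matrix.mul_smul, smul_smul,
      Matrix.mul_assoc]
    norm_num
  rw [h3, h, Matrix.mul_smul, Matrix.smul_mul, h2, smul_smul, smul_smul]
  congr 1
  ring

lemma fisherInfo_circle [NeZero n] (hn : 3 ≤ n) (k : ℕ) (c : ℝ) :
    fisherInfo (circleSchedule n k) (fun _ => c) =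
      (1 / 2 : ℝ) • influenceLaplacian (circleMatrix n k) := by
  rw [fisherInfo_const (circleSchedule_isSymm k) (circleSchedule_diag hn k),
    incidence_mul_winCov_mul_transpose hn]

/-- The inverse Fisher information of the circular tournament, up to a factor, when the ability of
player `0` is held fixed. -/
def refGreenMatrix (n : ℕ) [NeZero n] : Matrix (Fin n) (Fin n) ℝ :=
  Matrix.of fun a b => greenMatrix n a b - greenMatrix n a 0 - greenMatrix n 0 b + greenMatrix n 0 0

/-- The double difference of G vanishes in row 0, so the sum over the other players extends to all.
The terms constant in the summation index die because rows of L sum to zero, and the two entries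
-1/n of P cancel. -/
lemma refFisherInfo_mul [NeZero n] (hn : 3 ≤ n) {k : ℕ} (hk : 1 ≤ k) (c : ℝ) :
    refFisherInfo (circleSchedule n k) (fun _ => c) *
      ((2 / k : ℝ) • refGreenMatrix n).submatrix Subtype.val Subtype.val = 1 := by
  have hk0 : (k : ℝ) ≠ 0 := by positivity
  have hrow : ∀ a, ∑ b, influenceLaplacian (circleMatrix n k) a b = 0 := fun a => by
    have := congrFun (influenceLaplacian_circleMatrix_mulVec_const hn k 1) a
    simpa [mulVec, dotProduct] using this
  ext ⟨a, ha⟩ ⟨b, hb⟩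
  rw [refFisherInfo, fisherInfo_circle hn, mul_apply]
  simp only [submatrix_apply, Matrix.smul_apply, smul_eq_mul]
  have h1 : ∑ j : {a : Fin n // a ≠ 0}, 1 / 2 * influenceLaplacian (circleMatrix n k) a j.1 *
      (2 / k * refGreenMatrix n j.1 b) =
      ∑ j, 1 / 2 * influenceLaplacian (circleMatrix n k) a j * (2 / k * refGreenMatrix n j b) := by
    rw [← Finset.sum_subtype (Finset.univ.filter fun j : Fin n => j ≠ 0) (by simp) fun j : Fin n =>
      1 / 2 * influenceLaplacian (circleMatrix n k) a j * (2 / k * refGreenMatrix n j b)]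
    refine Finset.sum_filter_of_ne fun j _ hj h0 => hj ?_
    simp [h0, refGreenMatrix]
  have h2 : ∑ j, influenceLaplacian (circleMatrix n k) a j * refGreenMatrix n j b =
      k * (if a = b then 1 else 0) := by
    have e1 := congrFun (congrFun (influenceLaplacian_mul_greenMatrix hn k) a) b
    have e2 := congrFun (congrFun (influenceLaplacian_mul_greenMatrix hn k) a) 0
    simp only [mul_apply, Matrix.smul_apply, centering, Matrix.sub_apply, one_apply, of_apply, ha,
      if_false, smul_eq_mul] at e1 e2
    simp only [refGreenMatrix, of_apply, mul_add, mul_sub, Finset.sum_add_distrib,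
      Finset.sum_sub_distrib, e1, e2, ← Finset.sum_mul, hrow]
    ring
  have h3 : ∀ j, 1 / 2 * influenceLaplacian (circleMatrix n k) a j * (2 / k * refGreenMatrix n j b)
      = (1 / k) * (influenceLaplacian (circleMatrix n k) a j * refGreenMatrix n j b) :=
    fun j => by ring
  rw [h1]
  simp only [h3, ← Finset.mul_sum, h2, one_apply, Subtype.mk.injEq]
  field_simp

lemma isUnit_det_refFisherInfo [NeZero n] (hn : 3 ≤ n) {k : ℕ} (hk : 1 ≤ k) (c : ℝ) :
    IsUnit (refFisherInfo (circleSchedule n k) fun _ => c).det :=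
  isUnit_det_of_right_inverse (refFisherInfo_mul hn hk c)

lemma btRefCov_circle [NeZero n] (hn : 3 ≤ n) {k : ℕ} (hk : 1 ≤ k) (c : ℝ) :
    btRefCov (circleSchedule n k) (fun _ => c) = (2 / k : ℝ) • refGreenMatrix n := by
  ext a b
  rw [btRefCov, of_apply, inv_eq_right_inv (refFisherInfo_mul hn hk c)]
  by_cases ha : a = 0
  · simp [ha, refGreenMatrix]
  · by_cases hb : b = 0
    · simp [ha, hb, refGreenMatrix]
    · simp [ha, hb]

lemma jacobian_normalizedScores [NeZero n] (c : ℝ) :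
    jacobian (normalizedScores (n := n)) (fun _ => c) = centering n := by
  have hn0 : (n : ℝ) ≠ 0 := NeZero.ne _
  have h1 : HasFDerivAt (fun μ : Fin n → ℝ => ∑ j, Real.exp (μ j))
      (∑ j, Real.exp c • (ContinuousLinearMap.proj j : (Fin n → ℝ) →L[ℝ] ℝ)) (fun _ => c) :=
    HasFDerivAt.fun_sum fun j _ => (hasFDerivAt_apply j (fun _ : Fin n => c)).exp
  have h2 := h1.log (by simp [hn0, Real.exp_ne_zero])
  have h : HasFDerivAt (normalizedScores (n := n)) (ContinuousLinearMap.pi fun i =>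
      ContinuousLinearMap.proj i - _) (fun _ => c) :=
    hasFDerivAt_pi.2 fun i => (hasFDerivAt_apply i (fun _ : Fin n => c)).sub h2
  ext a b
  rw [jacobian, of_apply, h.fderiv]
  simp [centering, one_apply, Pi.single_apply, ← Finset.smul_sum]
  field_simp

lemma centering_mul_const [NeZero n] (f : Fin n → ℝ) :
    centering n * (Matrix.of fun _ b => f b) = 0 := by
  have hn0 : (n : ℝ) ≠ 0 := NeZero.ne _
  rw [centering, sub_mul, one_mul]
  ext a b
  simp [mul_apply, hn0]

/-- The reference player enters `refGreenMatrix` only through terms constant along rows or columns,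
which the projections on the two sides remove. -/
lemma btAsymptoticCov_circle [NeZero n] (hn : 3 ≤ n) {k : ℕ} (hk : 1 ≤ k) (c : ℝ) :
    btAsymptoticCov (circleSchedule n k) (fun _ => c) = (2 / k : ℝ) • greenMatrix n := by
  have hT : (centering n)ᵀ = centering n := by ext a b; exact centering_symm _ _
  have hG : centering n * greenMatrix n = greenMatrix n := by
    rw [centering, sub_mul, one_mul]
    ext a b
    simp [mul_apply, ← Finset.mul_sum, sum_greenMatrix_col]
  have hGT : (greenMatrix n)ᵀ = greenMatrix n := by ext a b; exact greenMatrix_symm _ _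
  have hG' : greenMatrix n * centering n = greenMatrix n := by
    rw [← hGT, ← transpose_inj, transpose_mul, hT, transpose_transpose, hG]
  have hR : refGreenMatrix n = greenMatrix n - (Matrix.of fun _ b => greenMatrix n b 0)ᵀ -
      (Matrix.of fun _ b => greenMatrix n 0 b - greenMatrix n 0 0) := by
    ext a b
    simp [refGreenMatrix]
    ring
  have hz : (Matrix.of fun (_ : Fin n) b => greenMatrix n b 0)ᵀ * centering n = 0 := by
    rw [← hT, ← transpose_mul, centering_mul_const, transpose_zero]
  rw [btAsymptoticCov, jacobian_normalizedScores, btRefCov_circle hn hk, hT, Matrix.mul_smul,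
    Matrix.smul_mul, hR, Matrix.mul_sub, Matrix.mul_sub, centering_mul_const, sub_zero, hG,
    Matrix.sub_mul, hG', Matrix.mul_assoc, hz, Matrix.mul_zero, sub_zero]

lemma winCov_posSemidef (N : Matrix (Fin n) (Fin n) ℕ) (c : ℝ) :
    (winCov N fun _ => c).PosSemidef := by
  rw [winCov_eq]
  exact PosSemidef.diagonal fun p => by positivity

lemma deltaMethodCov_posSemidef (C : Matrix (Fin n) (Fin n) ℕ) : (deltaMethodCov C).PosSemidef := by
  have := (winCov_posSemidef (C + Cᵀ) 0).mul_mul_conjTranspose_same (jacobian (perturbedLogIW C) 0)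
  rwa [conjTranspose_eq_transpose_of_trivial] at this

/-! ### Maximum likelihood -/

/-- This is p(1 - p) < 1/4 for p ≠ 1/2, after taking logarithms. -/
lemma sigmoid_mul_sigmoid_neg_lt {x : ℝ} (hx : x ≠ 0) :
    Real.log (Real.sigmoid x) + Real.log (Real.sigmoid (-x)) < 2 * Real.log (Real.sigmoid 0) := by
  have h1 := Real.sigmoid_pos x
  have h2 := Real.sigmoid_pos (-x)
  have h3 : Real.sigmoid x ≠ 1 / 2 := by
    rw [one_div, ← Real.sigmoid_zero]
    exact fun h => hx (Real.sigmoid_injective h)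
  rw [← Real.log_mul h1.ne' h2.ne', two_mul, ← Real.log_mul (by simp) (by simp)]
  refine Real.log_lt_log (mul_pos h1 h2) ?_
  rw [Real.sigmoid_neg, Real.sigmoid_zero]
  have := sq_pos_of_ne_zero (sub_ne_zero.2 h3)
  nlinarith

lemma btLogLik_symm {C : Matrix (Fin n) (Fin n) ℝ} (hC : C.IsSymm) (μ : Fin n → ℝ) :
    2 * btLogLik C μ = ∑ i, ∑ j, C i j *
      (Real.log (Real.sigmoid (μ i - μ j)) + Real.log (Real.sigmoid (-(μ i - μ j)))) := by
  simp only [mul_add, Finset.sum_add_distrib, two_mul]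
  congr 1
  rw [Finset.sum_comm, btLogLik]
  simp only [neg_sub, hC.apply]

/-- By symmetry of the data the likelihood splits into terms each maximal only at equal abilities; a
maximizer is therefore constant along every edge, and the cycle is connected. -/
lemma isBTEstimate_circle_iff [NeZero n] (hn : 3 ≤ n) {k : ℕ} (hk : 1 ≤ k) (μ : Fin n → ℝ) :
    IsBTEstimate (circleMatrix n k) μ ↔ ∃ c : ℝ, μ = fun _ => c := by
  have hk0 : (0 : ℝ) < k := by positivity
  have hC : (circleMatrix n k).IsSymm := by
    ext i j; exact circleMatrix_symm hn k j i
  have hnn : ∀ i j, 0 ≤ circleMatrix n k i j := fun i j => by simp [circleMatrix]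
  have hterm : ∀ (μ : Fin n → ℝ) i j, circleMatrix n k i j *
      (Real.log (Real.sigmoid (μ i - μ j)) + Real.log (Real.sigmoid (-(μ i - μ j)))) ≤
      circleMatrix n k i j * (2 * Real.log (Real.sigmoid 0)) := by
    intro μ i j
    refine mul_le_mul_of_nonneg_left ?_ (hnn i j)
    rcases eq_or_ne (μ i - μ j) 0 with h | h
    · simp [h, two_mul]
    · exact (sigmoid_mul_sigmoid_neg_lt h).le
  have hconst : ∀ c : ℝ, 2 * btLogLik (circleMatrix n k) (fun _ => c) =
      ∑ i, ∑ j, circleMatrix n k i j * (2 * Real.log (Real.sigmoid 0)) := by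
    intro c
    simp [btLogLik_symm hC, two_mul]
  constructor
  · intro h
    have h0 := h fun _ => 0
    have hle : ∑ i, ∑ j, circleMatrix n k i j * (2 * Real.log (Real.sigmoid 0)) ≤
        ∑ i, ∑ j, circleMatrix n k i j *
      (Real.log (Real.sigmoid (μ i - μ j)) + Real.log (Real.sigmoid (-(μ i - μ j)))) := by
      rw [← hconst 0, ← btLogLik_symm hC]
      linarith
    have hstep : ∀ i, μ (i + 1) = μ i := by
      intro i
      by_contra hne
      refine absurd hle (not_le.2 ?_)
      refine Finset.sum_lt_sum (fun i _ => Finset.sum_le_sum fun j _ => hterm μ i j)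
        ⟨i, Finset.mem_univ _, Finset.sum_lt_sum (fun j _ => hterm μ i j)
          ⟨i + 1, Finset.mem_univ _, ?_⟩⟩
      refine mul_lt_mul_of_pos_left (sigmoid_mul_sigmoid_neg_lt (sub_ne_zero.2 (Ne.symm hne))) ?_
      rw [circleMatrix_apply hn]
      split_ifs <;> simp_all
    have hall : ∀ m : ℕ, ∀ h : m < n, μ ⟨m, h⟩ = μ 0 := by
      intro m
      induction m with
      | zero => intro h; rfl
      | succ m ih =>
        intro h
        rw [← ih (by omega), ← hstep ⟨m, by omega⟩]
        congr 1
        ext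
        obtain ⟨l, rfl⟩ : ∃ l, n = l + 1 := ⟨n - 1, by omega⟩
        rw [Fin.val_add_one_of_lt (by simp [Fin.lt_def]; omega)]
    exact ⟨μ 0, funext fun i => hall i i.2⟩
  · rintro ⟨c, rfl⟩ ν
    have : 2 * btLogLik (circleMatrix n k) ν ≤ 2 * btLogLik (circleMatrix n k) fun _ => c := by
      rw [hconst, btLogLik_symm hC]
      exact Finset.sum_le_sum fun i _ => Finset.sum_le_sum fun j _ => hterm ν i j
    linarith

/-! ### The central limit theorem for the win counts -/

/-- The centred count is distributed as a sum of M independent signs ±1/2, each with characteristic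
function cos(θ/2); here it is the binomial theorem. -/
lemma integral_exp_centred_binomial (M : ℕ) {p : unitInterval} (hp : (p : ℝ) = 1 / 2) (θ : ℝ) :
    ∫ x, Complex.exp (((θ * ((x : ℝ) - M / 2) : ℝ) : ℂ) * Complex.I) ∂(binomial M p) =
      ((Real.cos (θ / 2) ^ M : ℝ) : ℂ) := by
  have hcos : ((Real.cos (θ / 2) : ℝ) : ℂ) = Complex.exp ((θ / 2 : ℝ) * Complex.I) / 2 +
      Complex.exp (-(θ / 2 : ℝ) * Complex.I) / 2 := by
    rw [Complex.ofReal_cos, Complex.cos]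
    ring
  rw [integral_binomial, Complex.ofReal_pow, hcos, add_pow, Nat.range_succ_eq_Iic]
  refine Finset.sum_congr rfl fun k hk => ?_
  have hkM : k ≤ M := Finset.mem_Iic.1 hk
  have hexp : Complex.exp (((θ * ((k : ℝ) - M / 2) : ℝ) : ℂ) * Complex.I) =
      Complex.exp ((θ / 2 : ℝ) * Complex.I) ^ k *
        Complex.exp (-(θ / 2 : ℝ) * Complex.I) ^ (M - k) := by
    rw [← Complex.exp_nat_mul, ← Complex.exp_nat_mul, ← Complex.exp_add, Nat.cast_sub hkM]
    congr 1
    push_cast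
    ring
  rw [hexp, hp, Complex.real_smul, div_pow, div_pow]
  push_cast
  have h2 : (1 - 1 / 2 : ℂ) = 1 / 2 := by norm_num
  rw [h2, div_pow, div_pow, one_pow, one_pow]
  ring

lemma tendsto_cos_pow (s : ℝ) (N : ℕ) :
    Tendsto (fun m : ℕ => Real.cos (s / √(m : ℝ) / 2) ^ (m * N)) atTop
      (𝓝 (Real.exp (-(s ^ 2 * (N / 4)) / 2))) := by
  have hg : Tendsto (fun m : ℕ => (m : ℝ) * (Real.cos (s / √(m : ℝ) / 2) - 1)) atTop
      (𝓝 (-(s ^ 2 / 8))) := by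
    have hsmall : Tendsto (fun m : ℕ => s / √(m : ℝ) / 2) atTop (𝓝 0) := by
      have : Tendsto (fun m : ℕ => √(m : ℝ)) atTop atTop :=
        Real.tendsto_sqrt_atTop.comp tendsto_natCast_atTop_atTop
      simpa using (this.const_div_atTop s).div_const 2
    rw [tendsto_iff_norm_sub_tendsto_zero]
    -- 5/96 is the constant of the quartic remainder in `Real.cos_bound`, applied at s/(2√m).
    refine squeeze_zero' (g := fun m : ℕ => s ^ 4 / 16 * (5 / 96) / (m : ℝ))
      (.of_forall fun _ => norm_nonneg _) ?_ (tendsto_const_div_atTop_nhds_zero_nat _)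
    have hev : ∀ᶠ m : ℕ in atTop, |s / √(m : ℝ) / 2| ≤ 1 := by
      have := (continuous_abs.tendsto _).comp hsmall
      rw [abs_zero] at this
      exact this.eventually_le_const one_pos
    filter_upwards [hev, eventually_gt_atTop 0] with m hm hm0
    have hm1 : (0 : ℝ) < m := by exact_mod_cast hm0
    have hsq : (s / √(m : ℝ) / 2) ^ 2 = s ^ 2 / m / 4 := by
      rw [div_pow, div_pow, Real.sq_sqrt hm1.le]; norm_num
    have h4 : |s / √(m : ℝ) / 2| ^ 4 = s ^ 4 / m ^ 2 / 16 := by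
      rw [show 4 = 2 * 2 by norm_num, pow_mul, sq_abs, hsq]
      ring
    have h := Real.cos_bound hm
    rw [hsq, h4] at h
    have e : (m : ℝ) * (Real.cos (s / √(m : ℝ) / 2) - 1) - -(s ^ 2 / 8) =
        m * (Real.cos (s / √(m : ℝ) / 2) - (1 - s ^ 2 / m / 4 / 2)) := by
      field_simp
      ring
    rw [e, Real.norm_eq_abs, abs_mul, abs_of_pos hm1]
    calc _ ≤ (m : ℝ) * (s ^ 4 / m ^ 2 / 16 * (5 / 96)) := by gcongr
      _ = _ := by field_simp
  have h := (Real.tendsto_one_add_pow_exp_of_tendsto hg).pow N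
  rw [← Real.exp_nat_mul] at h
  convert h using 2 with m
  · rw [add_sub_cancel, pow_mul]
  · congr 1
    ring

lemma integral_exp_centredWins (N : Matrix (Fin n) (Fin n) ℕ) (c : ℝ) (s : Pairing n → ℝ) :
    ∫ x, Complex.exp (((∑ p, s p * centredWins N x p : ℝ) : ℂ) * Complex.I)
      ∂(btLaw N fun _ => c) =
      ((∏ p : Pairing n, Real.cos (s p / 2) ^ N p.1.1 p.1.2 : ℝ) : ℂ) := by
  have h := integral_fintype_prod_eq_prod (μ := fun p : Pairing n => binomial (N p.1.1 p.1.2)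
    (unitInterval.sigmoid (c - c))) fun (p : Pairing n) (m : ℕ) =>
      Complex.exp (((s p * ((m : ℝ) - N p.1.1 p.1.2 / 2) : ℝ) : ℂ) * Complex.I)
  simp only [integral_exp_centred_binomial _ (sigmoid_const c), ← Complex.exp_sum] at h
  rw [Complex.ofReal_prod, ← h]
  simp only [Complex.ofReal_sum, Finset.sum_mul]
  rfl

lemma tendsto_integral_exp_centredWins (N : Matrix (Fin n) (Fin n) ℕ) (c : ℝ) (s : Pairing n → ℝ) :
    Tendsto (fun m : ℕ => ∫ x, Complex.exp
        (((∑ p, s p * ((√(m : ℝ))⁻¹ * centredWins (m • N) x p) : ℝ) : ℂ) * Complex.I)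
          ∂(btLaw (m • N) fun _ => c)) atTop
      (𝓝 (Complex.exp ((-(s ⬝ᵥ winCov N (fun _ => c) *ᵥ s) / 2 : ℝ) : ℂ))) := by
  have h1 : ∀ m : ℕ, (∫ x, Complex.exp
        (((∑ p, s p * ((√(m : ℝ))⁻¹ * centredWins (m • N) x p) : ℝ) : ℂ) * Complex.I)
          ∂(btLaw (m • N) fun _ => c)) =
      ((∏ p : Pairing n, Real.cos (s p / √(m : ℝ) / 2) ^ (m * N p.1.1 p.1.2) : ℝ) : ℂ) := by
    intro m
    have := integral_exp_centredWins (m • N) c fun p => s p / √(m : ℝ)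
    simp only [Matrix.smul_apply, smul_eq_mul] at this
    rw [← this]
    simp only [div_eq_mul_inv, mul_assoc]
  have h2 : Real.exp (-(s ⬝ᵥ winCov N (fun _ => c) *ᵥ s) / 2) =
      ∏ p : Pairing n, Real.exp (-(s p ^ 2 * (N p.1.1 p.1.2 / 4)) / 2) := by
    rw [← Real.exp_sum, winCov_eq, ← Finset.sum_div, Finset.sum_neg_distrib]
    simp only [dotProduct, mulVec_diagonal]
    congr 3
    exact Finset.sum_congr rfl fun p _ => by ring
  simp_rw [h1]
  rw [← Complex.ofReal_exp, h2]
  exact (Complex.continuous_ofReal.tendsto _).comp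
    (tendsto_finsetProd _ fun p _ => tendsto_cos_pow (s p) _)

/-! ### The delta method -/

lemma norm_exp_mul_I_sub_le (a b : ℝ) :
    ‖Complex.exp (a * Complex.I) - Complex.exp (b * Complex.I)‖ ≤ |a - b| := by
  have h : Complex.exp (a * Complex.I) - Complex.exp (b * Complex.I) =
      Complex.exp (b * Complex.I) * (Complex.exp (Complex.I * ((a - b : ℝ) : ℂ)) - 1) := by
    rw [mul_sub, ← Complex.exp_add, mul_one]
    congr 2
    push_cast
    ring
  rw [h, norm_mul, Complex.norm_exp_ofReal_mul_I, one_mul]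
  exact Real.norm_exp_I_mul_ofReal_sub_one_le

lemma norm_exp_mul_I_sub_le_two (a b : ℝ) :
    ‖Complex.exp (a * Complex.I) - Complex.exp (b * Complex.I)‖ ≤ 2 := by
  refine (norm_sub_le _ _).trans ?_
  rw [Complex.norm_exp_ofReal_mul_I, Complex.norm_exp_ofReal_mul_I]
  norm_num

lemma norm_sq_le_sum_sq {ι : Type*} [Fintype ι] (y : ι → ℝ) : ‖y‖ ^ 2 ≤ ∑ p, y p ^ 2 := by
  have h0 : 0 ≤ ∑ p, y p ^ 2 := Finset.sum_nonneg fun p _ => sq_nonneg _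
  rw [← Real.sq_sqrt h0]
  refine pow_le_pow_left₀ (norm_nonneg _) ?_ 2
  refine (pi_norm_le_iff_of_nonneg (Real.sqrt_nonneg _)).2 fun p => ?_
  rw [Real.norm_eq_abs]
  exact Real.abs_le_sqrt (Finset.single_le_sum (f := fun p => y p ^ 2)
    (fun p _ => sq_nonneg _) (Finset.mem_univ p))

lemma integral_norm_centredWins_sq_le (N : Matrix (Fin n) (Fin n) ℕ) (c : ℝ) :
    ∫ x, ‖centredWins N x‖ ^ 2 ∂(btLaw N fun _ => c) ≤ ∑ p : Pairing n, (N p.1.1 p.1.2 : ℝ) / 4 := by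
  refine (integral_mono (integrable_btLaw _ _ _) (integrable_btLaw _ _ _)
    fun x => norm_sq_le_sum_sq (centredWins N x)).trans_eq ?_
  rw [integral_finsetSum _ fun _ _ => integrable_btLaw _ _ _]
  simp only [integral_centredWins_sq]

/-- For small perturbations, θ ↦ exp(iθ) is 1-Lipschitz and the remainder of g is small; large ones
are rare by Chebyshev, and there the difference is at most 2. -/
lemma tendsto_integral_exp_sub_delta (N : Matrix (Fin n) (Fin n) ℕ) (c : ℝ)
    {g : (Pairing n → ℝ) → ℝ} {L : (Pairing n → ℝ) →L[ℝ] ℝ} (hg : HasFDerivAt g L 0) :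
    Tendsto (fun m : ℕ => ∫ x,
      (Complex.exp ((√(m : ℝ) * (g ((m : ℝ)⁻¹ • centredWins (m • N) x) - g 0) : ℝ) * Complex.I) -
        Complex.exp ((L ((√(m : ℝ))⁻¹ • centredWins (m • N) x) : ℝ) * Complex.I))
      ∂(btLaw (m • N) fun _ => c)) atTop (𝓝 0) := by
  set K : ℝ := ∑ p : Pairing n, (N p.1.1 p.1.2 : ℝ) / 4 with hK
  have hK0 : 0 ≤ K := Finset.sum_nonneg fun p _ => by positivity
  rw [Metric.tendsto_atTop']
  intro ε hε
  -- K bounds the mean of ‖y‖²/m, so this constant makes the near part integrate to at most ε/2.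
  obtain ⟨δ, hδ, hball⟩ := Metric.eventually_nhds_iff.1
    ((hasFDerivAt_iff_isLittleO_nhds_zero.1 hg).def (c := ε / (2 * (1 + K))) (by positivity))
  have hlim : Tendsto (fun m : ℕ => 2 * K / δ ^ 2 / (m : ℝ)) atTop (𝓝 0) :=
    tendsto_const_div_atTop_nhds_zero_nat _
  obtain ⟨M, hM⟩ := eventually_atTop.1 (hlim.eventually_lt_const (half_pos hε))
  refine ⟨M, fun m hm => ?_⟩
  have hm0 : (0 : ℝ) < m := by exact_mod_cast (Nat.zero_le _).trans_lt hm
  have hs : 0 < √(m : ℝ) := Real.sqrt_pos.2 hm0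
  have hss : √(m : ℝ) * √(m : ℝ) = m := Real.mul_self_sqrt hm0.le
  have hinv : (√(m : ℝ))⁻¹ = √(m : ℝ) * (m : ℝ)⁻¹ := by
    rw [eq_mul_inv_iff_mul_eq₀ hm0.ne', inv_mul_eq_iff_eq_mul₀ hs.ne', hss]
  -- One bound covers both regimes: the first summand serves the near case, the second exceeds 2 in
  -- the far case. No splitting of the integral is needed.
  have hpt : ∀ x : Pairing n → ℕ, ‖Complex.exp
        ((√(m : ℝ) * (g ((m : ℝ)⁻¹ • centredWins (m • N) x) - g 0) : ℝ) * Complex.I) -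
        Complex.exp ((L ((√(m : ℝ))⁻¹ • centredWins (m • N) x) : ℝ) * Complex.I)‖ ≤
      ε / (2 * (1 + K)) * (1 + ‖centredWins (m • N) x‖ ^ 2 / m) +
        2 / δ ^ 2 / m * (‖centredWins (m • N) x‖ ^ 2 / m) := by
    intro x
    set y := centredWins (m • N) x
    rcases lt_or_ge ‖(m : ℝ)⁻¹ • y‖ δ with h | h
    · have h1 := hball (y := (m : ℝ)⁻¹ • y) (by simpa using h)
      rw [zero_add] at h1
      have hL : L ((√(m : ℝ))⁻¹ • y) = √(m : ℝ) * L ((m : ℝ)⁻¹ • y) := by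
        rw [map_smul, map_smul, smul_eq_mul, smul_eq_mul, ← mul_assoc, hinv]
      refine (norm_exp_mul_I_sub_le _ _).trans ?_
      rw [hL, ← mul_sub, abs_mul, abs_of_pos hs]
      have h2 : √(m : ℝ) * ‖(m : ℝ)⁻¹ • y‖ ≤ 1 + ‖y‖ ^ 2 / m := by
        have : √(m : ℝ) * ‖(m : ℝ)⁻¹ • y‖ = ‖y‖ / √(m : ℝ) := by
          rw [norm_smul, norm_inv, Real.norm_of_nonneg hm0.le, ← mul_assoc, ← hinv, inv_mul_eq_div]
        rw [this]
        have e : ‖y‖ ^ 2 / m = (‖y‖ / √(m : ℝ)) ^ 2 := by rw [div_pow, Real.sq_sqrt hm0.le]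
        rw [e]
        nlinarith [sq_nonneg (‖y‖ / √(m : ℝ) - 1), sq_nonneg (‖y‖ / √(m : ℝ))]
      calc _ ≤ √(m : ℝ) * (ε / (2 * (1 + K)) * ‖(m : ℝ)⁻¹ • y‖) := by
            gcongr
            exact h1
        _ = ε / (2 * (1 + K)) * (√(m : ℝ) * ‖(m : ℝ)⁻¹ • y‖) := by ring
        _ ≤ ε / (2 * (1 + K)) * (1 + ‖y‖ ^ 2 / m) := by gcongr
        _ ≤ _ := le_add_of_nonneg_right (by positivity)
    · refine (norm_exp_mul_I_sub_le_two _ _).trans (le_add_of_nonneg_of_le (by positivity) ?_)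
      have h1 : δ * m ≤ ‖y‖ := by
        rw [norm_smul, norm_inv, Real.norm_of_nonneg hm0.le, inv_mul_eq_div, le_div_iff₀ hm0] at h
        exact h
      have h2 : (δ * m) ^ 2 ≤ ‖y‖ ^ 2 := pow_le_pow_left₀ (by positivity) h1 2
      calc (2 : ℝ) = 2 / δ ^ 2 / m * ((δ * m) ^ 2 / m) := by field_simp
        _ ≤ _ := by gcongr
  have hint : ∫ x, ‖centredWins (m • N) x‖ ^ 2 / m ∂(btLaw (m • N) fun _ => c) ≤ K := by
    rw [integral_div, div_le_iff₀ hm0]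
    refine (integral_norm_centredWins_sq_le _ c).trans_eq ?_
    rw [hK, Finset.sum_mul]
    refine Finset.sum_congr rfl fun p _ => ?_
    simp only [Matrix.smul_apply, smul_eq_mul, Nat.cast_mul]
    ring
  rw [dist_zero_right]
  refine (norm_integral_le_integral_norm _).trans_lt ?_
  refine (integral_mono (integrable_btLaw _ _ _) (integrable_btLaw _ _ _) hpt).trans_lt ?_
  rw [integral_add (integrable_btLaw _ _ _) (integrable_btLaw _ _ _), integral_const_mul,
    integral_const_mul, integral_add (integrable_btLaw _ _ _) (integrable_btLaw _ _ _)]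
  simp only [integral_const, probReal_univ, smul_eq_mul, mul_one]
  have h3 := hM m hm.le
  calc _ ≤ ε / (2 * (1 + K)) * (1 + K) + 2 / δ ^ 2 / m * K := by gcongr
    _ = ε / 2 + 2 * K / δ ^ 2 / m := by field_simp
    _ < ε := by linarith

/-! ### Asymptotic efficiency -/

lemma normalizedScores_const [NeZero n] (c : ℝ) :
    normalizedScores (n := n) (fun _ => c) = fun _ => -Real.log n := by
  have hn0 : (n : ℝ) ≠ 0 := NeZero.ne _
  ext i
  simp [normalizedScores, Real.log_mul hn0 (Real.exp_ne_zero c)]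

lemma perturb_smul {c : ℝ} (hc : c ≠ 0) (C : Matrix (Fin n) (Fin n) ℝ) (t : Pairing n → ℝ) :
    perturb (c • C) t = c • perturb C (c⁻¹ • t) := by
  rw [perturb_eq, perturb_eq, map_smul, smul_add, smul_inv_smul₀ hc]

/-- Scale invariance removes the factor m, leaving a perturbation of the fixed tournament that
shrinks with m. -/
lemma logInfluenceWeight_winMatrix [NeZero n] (hn : 3 ≤ n) (k : ℕ) {m : ℕ} (hm : m ≠ 0)
    (x : Pairing n → ℕ) :
    logInfluenceWeight (winMatrix (m • circleSchedule n k) x) =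
      perturbedLogIW (circleCitations n k)
        ((m : ℝ)⁻¹ • centredWins (m • circleSchedule n k) x) := by
  have hm0 : (m : ℝ) ≠ 0 := by exact_mod_cast hm
  have hsymm : (m • circleSchedule n k).IsSymm := (circleSchedule_isSymm k).smul m
  have hC : (Matrix.of fun i j => ((m • circleSchedule n k) i j : ℝ) / 2) =
      (m : ℝ) • circleMatrix n k := by
    ext i j
    simp only [of_apply, Matrix.smul_apply, smul_eq_mul, Nat.cast_mul, circleSchedule_cast hn]
    ring
  rw [winMatrix_eq_perturb hsymm (by simp [circleSchedule_diag hn]), hC, perturb_smul hm0,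
    logInfluenceWeight_smul hm0]
  rfl

lemma isAsymptoticallyEfficientAt_circle [NeZero n] (hn : 3 ≤ n) {k : ℕ} (hk : 1 ≤ k) (c : ℝ) :
    IsAsymptoticallyEfficientAt (circleSchedule n k) logInfluenceWeight (fun _ => c) := by
  have hcov : btAsymptoticCov (circleSchedule n k) (fun _ => c) =
      deltaMethodCov (circleCitations n k) := by
    rw [btAsymptoticCov_circle hn hk, deltaMethodCov_circle hn hk]
  have hpsd : (btAsymptoticCov (circleSchedule n k) fun _ => c).PosSemidef := by
    rw [hcov]
    exact deltaMethodCov_posSemidef _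
  refine ⟨isUnit_det_refFisherInfo hn hk c, hpsd, ?_⟩
  refine ⟨fun m => (measurable_of_countable _).aemeasurable, aemeasurable_id, ?_⟩
  refine ProbabilityMeasure.tendsto_iff_tendsto_charFun.2 fun t => ?_
  simp only [ProbabilityMeasure.coe_mk, Measure.map_id]
  rw [charFun_multivariateGaussian hpsd, hcov, inner_zero_right, Complex.ofReal_zero, zero_mul,
    zero_sub]
  obtain ⟨D, hD, hderiv⟩ := hasFDerivAt_perturbedLogIW hn hk
  set J := jacobian (perturbedLogIW (circleCitations n k)) 0 with hJ
  have hDJ : ∀ v, D v = J *ᵥ v := fun v => by rw [hD, hJ, jacobian_perturbedLogIW hn hk]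
  -- Pulling the frequency t back along the Jacobian reduces the Gaussian limit to that of the
  -- counts at s.
  set s : Pairing n → ℝ := t.ofLp ᵥ* J with hs
  have hquad : t.ofLp ⬝ᵥ deltaMethodCov (circleCitations n k) *ᵥ t.ofLp =
      s ⬝ᵥ winCov (circleSchedule n k) (fun _ => c) *ᵥ s := by
    have : winCov (circleSchedule n k) (fun _ => c) = winCov (circleSchedule n k) (fun _ => 0) := by
      rw [winCov_eq, winCov_eq]
    rw [this, hs, ← mulVec_transpose J t.ofLp, mulVec_mulVec, mulVec_transpose, ← dotProduct_mulVec,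
      mulVec_mulVec, ← Matrix.mul_assoc]
    rfl
  have hlin := tendsto_integral_exp_centredWins (circleSchedule n k) c s
  let Lt : (Fin n → ℝ) →L[ℝ] ℝ := ∑ i, t.ofLp i • (ContinuousLinearMap.proj i)
  have hLt : ∀ v, Lt v = t.ofLp ⬝ᵥ v := fun v => by
    simp [Lt, dotProduct]
  have hg := Lt.hasFDerivAt.comp (0 : Pairing n → ℝ) hderiv
  have hdelta := (tendsto_integral_exp_sub_delta (circleSchedule n k) c hg).add hlin
  rw [zero_add, ← hquad] at hdelta
  have hfin : Complex.exp ((-(t.ofLp ⬝ᵥ deltaMethodCov (circleCitations n k) *ᵥ t.ofLp) / 2 : ℝ) : ℂ)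
      = Complex.exp (-(((t.ofLp ⬝ᵥ deltaMethodCov (circleCitations n k) *ᵥ t.ofLp : ℝ) : ℂ) / 2)) := by
    congr 1
    push_cast
    ring
  rw [hfin] at hdelta
  refine hdelta.congr' ?_
  -- For m ≠ 0 the characteristic function is the linearized one plus the delta-method error, whose
  -- limits are known.
  filter_upwards [eventually_ne_atTop 0] with m hm
  rw [charFun_apply, integral_map (measurable_of_countable _).aemeasurable (by fun_prop)]
  have hlinear : ∀ x, (Lt ∘L D) ((√(m : ℝ))⁻¹ • centredWins (m • circleSchedule n k) x) =
      ∑ p, s p * ((√(m : ℝ))⁻¹ * centredWins (m • circleSchedule n k) x p) := by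
    intro x
    rw [ContinuousLinearMap.comp_apply, hLt, hDJ, dotProduct_mulVec]
    rfl
  rw [← integral_add (integrable_btLaw _ _ _) (integrable_btLaw _ _ _)]
  refine integral_congr_ae (.of_forall fun x => ?_)
  simp only [hlinear, sub_add_cancel]
  congr 3
  rw [logInfluenceWeight_winMatrix hn k hm, normalizedScores_const c, ← perturbedLogIW_zero hn hk]
  simp only [Function.comp_apply, hLt, EuclideanSpace.inner_eq_star_dotProduct]
  simp only [star_trivial, dotProduct_smul, dotProduct_sub, smul_eq_mul]

end PairedComparison

end

theorem mainTheorem3 (n k : ℕ) [NeZero n] (hn : 3 ≤ n) (hk : 1 ≤ k) :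
    -- the unperturbed influence weight is uniform
    (∀ w : Fin n → ℝ,
      PairedComparison.IsInfluenceWeight
        ((PairedComparison.circleCitations n k).map (fun c => (c : ℝ))) w ↔
      w = fun _ => 1 / (n : ℝ)) ∧
    -- the delta method applies, with the following covariances in all bands
    DifferentiableAt ℝ
      (PairedComparison.perturbedLogIW (PairedComparison.circleCitations n k)) 0 ∧
    (∀ i j : Fin n,
      PairedComparison.deltaMethodCov (PairedComparison.circleCitations n k) i j =
        ((n : ℝ) ^ 2 - 1 - 6 * |(i : ℝ) - (j : ℝ)| * ((n : ℝ) - |(i : ℝ) - (j : ℝ)|))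
          / (6 * (k : ℝ) * (n : ℝ))) ∧
    (∀ i : Fin n,
      PairedComparison.deltaMethodCov (PairedComparison.circleCitations n k) i i =
        ((n : ℝ) ^ 2 - 1) / (6 * (k : ℝ) * (n : ℝ))) ∧
    (∀ i j : Fin n, |(i : ℝ) - (j : ℝ)| = 1 →
      PairedComparison.deltaMethodCov (PairedComparison.circleCitations n k) i j =
        ((n : ℝ) - 1) * ((n : ℝ) - 5) / (6 * (k : ℝ) * (n : ℝ))) ∧
    (∀ i j : Fin n, |(i : ℝ) - (j : ℝ)| = 2 →
      PairedComparison.deltaMethodCov (PairedComparison.circleCitations n k) i j =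
        ((n : ℝ) ^ 2 - 12 * (n : ℝ) + 23) / (6 * (k : ℝ) * (n : ℝ))) ∧
    -- the Bradley-Terry fit to the same data gives equal abilities
    (∀ μ : Fin n → ℝ,
      PairedComparison.IsBTEstimate
        ((PairedComparison.circleCitations n k).map (fun c => (c : ℝ))) μ ↔
      ∃ c : ℝ, μ = fun _ => c) ∧
    -- the Bradley-Terry asymptotic covariances are the same, and efficiency holds
    (∀ c : ℝ,
      PairedComparison.btAsymptoticCov
        (PairedComparison.circleCitations n k + (PairedComparison.circleCitations n k)ᵀ)
        (fun _ => c) =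
      PairedComparison.deltaMethodCov (PairedComparison.circleCitations n k)) ∧
    (∀ c : ℝ,
      PairedComparison.IsAsymptoticallyEfficientAt
        (PairedComparison.circleCitations n k + (PairedComparison.circleCitations n k)ᵀ)
        PairedComparison.logInfluenceWeight (fun _ => c)) := by
  have hV : ∀ i j : Fin n, PairedComparison.deltaMethodCov (PairedComparison.circleCitations n k) i j
      = ((n : ℝ) ^ 2 - 1 - 6 * |(i : ℝ) - (j : ℝ)| * ((n : ℝ) - |(i : ℝ) - (j : ℝ)|))
          / (6 * (k : ℝ) * (n : ℝ)) := by
    intro i j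
    have hk0 : (k : ℝ) ≠ 0 := by positivity
    have hn0 : (n : ℝ) ≠ 0 := NeZero.ne _
    rw [PairedComparison.deltaMethodCov_circle hn hk]
    simp only [Matrix.smul_apply, PairedComparison.greenMatrix, PairedComparison.cycleGreen,
      Matrix.of_apply, smul_eq_mul]
    field_simp
    ring
  obtain ⟨D, -, hD⟩ := PairedComparison.hasFDerivAt_perturbedLogIW hn hk
  refine ⟨PairedComparison.isInfluenceWeight_circle_iff hn hk, hD.differentiableAt, hV, ?_, ?_, ?_,
    PairedComparison.isBTEstimate_circle_iff hn hk, fun c => ?_,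
    PairedComparison.isAsymptoticallyEfficientAt_circle hn hk⟩
  · intro i
    rw [hV]
    simp
  · intro i j h
    rw [hV, h]
    ring
  · intro i j h
    rw [hV, h]
    ring
  · rw [PairedComparison.deltaMethodCov_circle hn hk]
    exact PairedComparison.btAsymptoticCov_circle hn hk c
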